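/- Let $P\in\mathbb C[x]$ be a monic polynomial of degree $n$, and let $\mathcal A_P$ be the $\mathbb C$-algebra generated by $u,v,z$ with relations $$[z,u]=-u,\quad [z,v]=v,\quad vu=P(z-\tfrac12),\quad uv=P(z+\tfrac12).$$ For $t\in\mathbb C^\times$ let $g_t$ be the automorphism of $\mathcal A_P$ with $g_t(v)=tv$, $g_t(u)=t^{-1}u$, $g_t(z)=z$. Let $\rho$ be an antilinear ring automorphism of $\mathcal A_P$ with $$\rho(v)=\lambda u,\quad \rho(u)=\lambda_* v,\quad \rho(z)=-z\qquad(\lambda,\lambda_*\in\mathbb C^\times),$$ and let $t\in\mathbb C^\times$ be such that $\rho^2=g_t$. Let $P_\circ$ be the monic polynomial whose roots are the roots $\alpha$ of $P$ with $|\mathrm{Re}\,\alpha|\le\frac12$, with the same multiplicities as in $P$, and let $n_\circ=\deg P_\circ$. A $g_t$-twisted trace on $\mathcal A_P$ is a linear map $T:\mathcal A_P\to\mathbb C$ with $T(ab)=T(b\,g_t(a))$ for all $a,b$; it is identified with the functional $R\mapsto T(R(z))$ on $\mathbb C[x]$. It gives a positive definite form with respect to $\rho$ if $(a,b)=T(a\rho(b))$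 is a positive definite Hermitian form on $\mathcal A_P$. The cone of positive definite forms on $\mathcal A_P$ with respect to $\rho$ is the set of positive definite Hermitian forms (linear in the first variable) with $(a\rho(y),b)=(a,yb)$ for all $a,b,y\in\mathcal A_P$. The same notions are used for $\mathcal A_{P_\circ}$. Then $n-n_\circ$ is a nonnegative even integer and, with $\lambda_\circ=(-1)^{(n-n_\circ)/2}\lambda$, there is an antilinear ring automorphism $\rho_\circ$ of $\mathcal A_{P_\circ}$ with $$\rho_\circ(v)=\lambda_\circ u,\quad \rho_\circ(u)=(-1)^n\lambda_\circ^{-1}v,\quad \rho_\circ(z)=-z,$$ satisfying $\rho_\circ^2=g_t$. For this $\rho_\circ$: 1. A linear functional $T:\mathbb C[x]\to\mathbb C$ is a $g_t$-twisted trace for $\mathcal A_P$ giving a positive definite form with respect to $\rho$ if and only if it is a $g_t$-twisted trace for $\mathcal A_{P_\circ}$ giving a positive definite form with respect to $\rho_\circ$. 2. The cone of positive definite forms on $\mathcal A_P$ with respect to $\rho$ coincides with the cone of positive definite forms on $\mathcal A_{P_\circ}$ with respect to $\rho_\circ$: on each of the two cones the map sending a form to the functional $R\mapsto (R(z),1)$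 on $\mathbb C[x]$ is injective, and the two cones have the same image in the space of linear functionals on $\mathbb C[x]$. -/

import Mathlib

open scoped Polynomial

namespace KleinianTrace

/-- The three generators of the algebra `𝒜_P`. -/
inductive Gen : Type
  | u
  | v
  | z

/-- The defining relations of `𝒜_P` in the free algebra on `u, v, z`:
`[z,u] = -u`, `[z,v] = v`, `vu = P(z - 1/2)`, `uv = P(z + 1/2)`. -/
inductive Rel (P : ℂ[X]) : FreeAlgebra ℂ Gen → FreeAlgebra ℂ Gen → Prop
  | zu : Rel P
      (FreeAlgebra.ι ℂ Gen.z * FreeAlgebra.ι ℂ Gen.u - FreeAlgebra.ι ℂ Gen.u * FreeAlgebra.ι ℂ Gen.z)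
      (-FreeAlgebra.ι ℂ Gen.u)
  | zv : Rel P
      (FreeAlgebra.ι ℂ Gen.z * FreeAlgebra.ι ℂ Gen.v - FreeAlgebra.ι ℂ Gen.v * FreeAlgebra.ι ℂ Gen.z)
      (FreeAlgebra.ι ℂ Gen.v)
  | vu : Rel P
      (FreeAlgebra.ι ℂ Gen.v * FreeAlgebra.ι ℂ Gen.u)
      (Polynomial.aeval (FreeAlgebra.ι ℂ Gen.z - algebraMap ℂ (FreeAlgebra ℂ Gen) (1 / 2)) P)
  | uv : Rel P
      (FreeAlgebra.ι ℂ Gen.u * FreeAlgebra.ι ℂ Gen.v)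
      (Polynomial.aeval (FreeAlgebra.ι ℂ Gen.z + algebraMap ℂ (FreeAlgebra ℂ Gen) (1 / 2)) P)

/-- The generalized Weyl algebra `𝒜_P` given by generators and relations. -/
def Alg (P : ℂ[X]) : Type := RingQuot (Rel P)

noncomputable section

instance (P : ℂ[X]) : Ring (Alg P) := inferInstanceAs (Ring (RingQuot (Rel P)))

instance (P : ℂ[X]) : Algebra ℂ (Alg P) := inferInstanceAs (Algebra ℂ (RingQuot (Rel P)))

/-- The quotient map from the free algebra. -/
def mk (P : ℂ[X]) : FreeAlgebra ℂ Gen →ₐ[ℂ] Alg P := RingQuot.mkAlgHom ℂ (Rel P)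

theorem mk_rel (P : ℂ[X]) {a b : FreeAlgebra ℂ Gen} (h : Rel P a b) : mk P a = mk P b :=
  RingQuot.mkAlgHom_rel ℂ h

/-- The image in `𝒜_P` of a generator. -/
def gen (P : ℂ[X]) (x : Gen) : Alg P := mk P (FreeAlgebra.ι ℂ x)

/-- The generator `u` of `𝒜_P`. -/
def u (P : ℂ[X]) : Alg P := gen P Gen.u

/-- The generator `v` of `𝒜_P`. -/
def v (P : ℂ[X]) : Alg P := gen P Gen.v

/-- The generator `z` of `𝒜_P`. -/
def z (P : ℂ[X]) : Alg P := gen P Gen.z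

theorem z_mul_u (P : ℂ[X]) : z P * u P - u P * z P = -u P := by
  have h := mk_rel P (Rel.zu (P := P))
  simp only [map_sub, map_mul, map_neg] at h
  exact h

theorem z_mul_v (P : ℂ[X]) : z P * v P - v P * z P = v P := by
  have h := mk_rel P (Rel.zv (P := P))
  simp only [map_sub, map_mul] at h
  exact h

theorem v_mul_u (P : ℂ[X]) :
    v P * u P = Polynomial.aeval (z P - algebraMap ℂ (Alg P) (1 / 2)) P := by
  have h := mk_rel P (Rel.vu (P := P))
  rw [map_mul, ← Polynomial.aeval_algHom_apply, map_sub, AlgHom.commutes] at h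
  exact h

theorem u_mul_v (P : ℂ[X]) :
    u P * v P = Polynomial.aeval (z P + algebraMap ℂ (Alg P) (1 / 2)) P := by
  have h := mk_rel P (Rel.uv (P := P))
  rw [map_mul, ← Polynomial.aeval_algHom_apply, map_add, AlgHom.commutes] at h
  exact h

/-- The values of `g_t` on the generators: `u ↦ t⁻¹ u`, `v ↦ t v`, `z ↦ z`. -/
def twistGen (P : ℂ[X]) (t : ℂˣ) : Gen → Alg P
  | Gen.u => ((t⁻¹ : ℂˣ) : ℂ) • u P
  | Gen.v => (t : ℂ) • v P
  | Gen.z => z P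

theorem twistGen_rel (P : ℂ[X]) (t : ℂˣ) ⦃a b : FreeAlgebra ℂ Gen⦄ (h : Rel P a b) :
    FreeAlgebra.lift ℂ (twistGen P t) a = FreeAlgebra.lift ℂ (twistGen P t) b := by
  cases h with
  | zu =>
    simp only [map_sub, map_mul, map_neg, FreeAlgebra.lift_ι_apply, twistGen, mul_smul_comm,
      smul_mul_assoc]
    rw [← smul_sub, z_mul_u, smul_neg]
  | zv =>
    simp only [map_sub, map_mul, FreeAlgebra.lift_ι_apply, twistGen, mul_smul_comm,
      smul_mul_assoc]
    rw [← smul_sub, z_mul_v]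
  | vu =>
    rw [← Polynomial.aeval_algHom_apply, map_sub, AlgHom.commutes]
    simp only [map_mul, FreeAlgebra.lift_ι_apply, twistGen, mul_smul_comm,
      smul_mul_assoc, smul_smul, Units.inv_mul, one_smul, v_mul_u]
  | uv =>
    rw [← Polynomial.aeval_algHom_apply, map_add, AlgHom.commutes]
    simp only [map_mul, FreeAlgebra.lift_ι_apply, twistGen, mul_smul_comm,
      smul_mul_assoc, smul_smul, Units.mul_inv, one_smul, u_mul_v]

/-- The endomorphism (in fact automorphism, with inverse `g_{t⁻¹}`) `g_t` of `𝒜_P`: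
`g_t(v) = t v`, `g_t(u) = t⁻¹ u`, `g_t(z) = z`. -/
def twist (P : ℂ[X]) (t : ℂˣ) : Alg P →ₐ[ℂ] Alg P :=
  RingQuot.liftAlgHom ℂ (s := Rel P) ⟨FreeAlgebra.lift ℂ (twistGen P t), twistGen_rel P t⟩

theorem twist_gen (P : ℂ[X]) (t : ℂˣ) (x : Gen) : twist P t (gen P x) = twistGen P t x :=
  (RingQuot.liftAlgHom_mkAlgHom_apply ℂ (FreeAlgebra.lift ℂ (twistGen P t)) (twistGen_rel P t)
    (FreeAlgebra.ι ℂ x)).trans (FreeAlgebra.lift_ι_apply _ _)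

/-- `ρ` is the conjugation of `𝒜_P` (antilinear ring automorphism) given by
`ρ(v) = lam u`, `ρ(u) = lamStar v`, `ρ(z) = -z`. -/
structure IsConjugation (P : ℂ[X]) (lam lamStar : ℂ) (ρ : Alg P ≃+* Alg P) : Prop where
  antilinear : ∀ (c : ℂ) (a : Alg P), ρ (c • a) = (starRingEnd ℂ) c • ρ a
  map_v : ρ (v P) = lam • u P
  map_u : ρ (u P) = lamStar • v P
  map_z : ρ (z P) = -z P

/-- `T` is a `g_t`-twisted trace on `𝒜_P`: `T(ab) = T(b g_t(a))`. -/
def IsTwistedTrace (P : ℂ[X]) (t : ℂˣ) (T : Alg P →ₗ[ℂ] ℂ) : Prop :=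
  ∀ a b : Alg P, T (a * b) = T (b * twist P t a)

/-- A pairing on `𝒜_P` is Hermitian and positive definite. -/
def IsPosDefHermitian (P : ℂ[X]) (B : Alg P → Alg P → ℂ) : Prop :=
  (∀ a b, B b a = (starRingEnd ℂ) (B a b)) ∧ ∀ a, a ≠ 0 → 0 < (B a a).re

/-- The functional `T` on `ℂ[x]` is (the restriction to `ℂ[z]` of) a `g_t`-twisted trace on `𝒜_P`,
and the form `(a, b) = T(a ρ(b))` is a positive definite Hermitian form on `𝒜_P`. -/
def IsPositiveTrace (P : ℂ[X]) (t : ℂˣ) (ρ : Alg P ≃+* Alg P) (T : ℂ[X] →ₗ[ℂ] ℂ) : Prop :=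
  ∃ T' : Alg P →ₗ[ℂ] ℂ, IsTwistedTrace P t T' ∧
    (∀ R : ℂ[X], T' (Polynomial.aeval (z P) R) = T R) ∧
    IsPosDefHermitian P (fun a b => T' (a * ρ b))

/-- The cone of positive definite Hermitian `ρ`-invariant forms on `𝒜_P`
(linear in the first and antilinear in the second variable). -/
def positiveCone (P : ℂ[X]) (ρ : Alg P ≃+* Alg P) :
    Set (Alg P →ₗ[ℂ] Alg P →ₛₗ[starRingEnd ℂ] ℂ) :=
  {B | IsPosDefHermitian P (fun a b => B a b) ∧ ∀ a b y, B (a * ρ y) b = B a (y * b)}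

/-- The functional `R ↦ (R(z), 1)` on `ℂ[x]` attached to a form on `𝒜_P`. -/
def formFunctional (P : ℂ[X]) (B : Alg P →ₗ[ℂ] Alg P →ₛₗ[starRingEnd ℂ] ℂ) : ℂ[X] →ₗ[ℂ] ℂ where
  toFun R := B (Polynomial.aeval (z P) R) 1
  map_add' R S := by simp
  map_smul' c R := by simp

open Classical in
/-- The monic polynomial `P_∘` whose roots are the roots `α` of `P` with `|Re α| ≤ 1/2`,
with the same multiplicities. -/
def stripPart (P : ℂ[X]) : ℂ[X] :=
  ((P.roots.filter (fun α : ℂ => |α.re| ≤ 1 / 2)).map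
    (fun α => Polynomial.X - Polynomial.C α)).prod

/-- `lam_∘ = (-1)^((n - n_∘)/2) lam`, where `n = deg P` and `n_∘ = deg P_∘`. -/
def stripScalar (P : ℂ[X]) (lam : ℂ) : ℂ :=
  (-1) ^ ((P.natDegree - (stripPart P).natDegree) / 2) * lam

end

end KleinianTrace

/-! Write R*(x) for the conjugate of R(-x̄). The algebra is graded by the adjoint action of z, a
twisted trace lives in weight 0, and different weights are orthogonal for the form. Conjugating by v
or u lowers the absolute weight by two, so positivity needs checking only in weights 0 and 1. A
positive trace is thus a functional T on ℂ[x] satisfying the trace equation on multiples of P, T(R*)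
= conj T(R), T(RR*) > 0, and positivity of b(RR*), where b(R) = lam · T((RP)(x - 1/2))
(`isPositiveTrace_iff`). Forms in the cone correspond to these traces.

The existence of ρ makes the roots of P symmetric under α ↦ -ᾱ, so P = P_∘ · N with N = (-1)^k M M*
and M collecting the roots right of the strip. Passing from P_∘ to P replaces R by MR in the last
condition. The converse is a density statement: multiples of N approximate 1 on both lines Re x =
±1/2, in the seminorm T(RR*) after shifting by ±1/2 and against finitely many test polynomials
(`exists_tendsto_stripForm`).

For a root α outside the closed strip, e^{s(x-α)} equals 1 at α, and for small real s of the right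
sign its modulus is below 1 on both lines. The trace equation forces |T(x^k)| ≤ C k! A^k
(`exists_hasMomentBound`), so Taylor polynomials inherit this contraction
(`tendsto_quadForm_truncExp`). Iterating gives e with e(α) = 1 and arbitrarily small seminorm; 1 - e
is then a multiple of x - α close to 1, and roots are treated one at a time. Cauchy–Schwarz carries
the trace equation and nonnegativity of b to the limit; a second use of it gives strict positivity
(`IsPositiveFunctional.of_mul_conjNeg`). -/

namespace KleinianTrace

noncomputable section

/-! ### Shifts and the involution R ↦ R* on ℂ[x]. -/

/-- The shift `R(x) ↦ R(x + c)`. -/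
def shift (c : ℂ) : ℂ[X] →ₐ[ℂ] ℂ[X] := Polynomial.aeval (Polynomial.X + Polynomial.C c)

/-- The antilinear involution sending `R(x)` to the polynomial with value `conj (R (-conj x))`. -/
def conjNeg : ℂ[X] →+* ℂ[X] :=
  Polynomial.eval₂RingHom (Polynomial.C.comp (starRingEnd ℂ)) (-Polynomial.X)

@[simp] theorem shift_X (c : ℂ) : shift c Polynomial.X = Polynomial.X + Polynomial.C c := by
  simp [shift]

@[simp] theorem shift_C (c a : ℂ) : shift c (Polynomial.C a) = Polynomial.C a := by
  simp [shift]

@[simp] theorem shift_shift (a b : ℂ) (R : ℂ[X]) : shift a (shift b R) = shift (a + b) R := by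
  have : (shift a).comp (shift b) = shift (a + b) := by
    ext1
    simp [add_assoc]
  exact DFunLike.congr_fun this R

@[simp] theorem shift_zero (R : ℂ[X]) : shift 0 R = R := by
  simp [shift]

theorem shift_injective (c : ℂ) : Function.Injective (shift c) := fun R S h => by
  simpa using congrArg (shift (-c)) h

@[simp] theorem shift_eq_zero {c : ℂ} {R : ℂ[X]} : shift c R = 0 ↔ R = 0 :=
  map_eq_zero_iff _ (shift_injective c)

@[simp] theorem conjNeg_X : conjNeg Polynomial.X = -Polynomial.X := by
  simp [conjNeg]

@[simp] theorem conjNeg_C (a : ℂ) :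
    conjNeg (Polynomial.C a) = Polynomial.C ((starRingEnd ℂ) a) := by
  simp [conjNeg]

@[simp] theorem conjNeg_smul (a : ℂ) (R : ℂ[X]) :
    conjNeg (a • R) = (starRingEnd ℂ) a • conjNeg R := by
  simp [Polynomial.smul_eq_C_mul]

@[simp] theorem conjNeg_conjNeg (R : ℂ[X]) : conjNeg (conjNeg R) = R := by
  have : conjNeg.comp conjNeg = RingHom.id _ := by
    apply Polynomial.ringHom_ext <;> simp
  exact DFunLike.congr_fun this R

theorem conjNeg_injective : Function.Injective conjNeg :=
  Function.LeftInverse.injective conjNeg_conjNeg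

@[simp] theorem conjNeg_eq_zero {R : ℂ[X]} : conjNeg R = 0 ↔ R = 0 :=
  map_eq_zero_iff _ conjNeg_injective

theorem conjNeg_shift (c : ℂ) (R : ℂ[X]) :
    conjNeg (shift c R) = shift (-(starRingEnd ℂ) c) (conjNeg R) := by
  have : conjNeg.comp (shift c).toRingHom
      = (shift (-(starRingEnd ℂ) c)).toRingHom.comp conjNeg := by
    apply Polynomial.ringHom_ext
    · simp
    · simp [add_comm]
  exact DFunLike.congr_fun this R

/-! ### Weight vectors span the algebra over ℂ[z]. -/

variable {P : ℂ[X]}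

/-- The element `R(z)` of `𝒜_P`. -/
def polyZ (P : ℂ[X]) : ℂ[X] →ₐ[ℂ] Alg P := Polynomial.aeval (z P)

@[simp] theorem polyZ_X : polyZ P Polynomial.X = z P := by simp [polyZ]

@[simp] theorem polyZ_C (c : ℂ) : polyZ P (Polynomial.C c) = algebraMap ℂ _ c := by simp [polyZ]

theorem v_mul_u_eq : v P * u P = polyZ P (shift (-(1 / 2)) P) := by
  rw [v_mul_u, polyZ, shift, ← Polynomial.aeval_algHom_apply]
  simp [sub_eq_add_neg]

theorem u_mul_v_eq : u P * v P = polyZ P (shift (1 / 2) P) := by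
  rw [u_mul_v, polyZ, shift, ← Polynomial.aeval_algHom_apply]
  simp

theorem Alg.induction {C : Alg P → Prop} (hc : ∀ c : ℂ, C (algebraMap ℂ _ c))
    (hu : C (u P)) (hv : C (v P)) (hz : C (z P))
    (hadd : ∀ a b, C a → C b → C (a + b)) (hmul : ∀ a b, C a → C b → C (a * b)) (a : Alg P) :
    C a := by
  obtain ⟨a, rfl⟩ := RingQuot.mkAlgHom_surjective ℂ (Rel P) a
  change C (mk P a)
  induction a using FreeAlgebra.induction with
  | grade0 c => rw [AlgHom.commutes]; exact hc c
  | grade1 x => cases x; exacts [hu, hv, hz]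
  | mul a b ha hb => rw [map_mul]; exact hmul _ _ ha hb
  | add a b ha hb => rw [map_add]; exact hadd _ _ ha hb

/-- `a` has weight `k` for the adjoint action of `z`. -/
def IsWeight (k : ℤ) (a : Alg P) : Prop := z P * a - a * z P = (k : ℂ) • a

theorem isWeight_u : IsWeight (-1) (u P) := by
  simp [IsWeight, z_mul_u]

theorem isWeight_v : IsWeight 1 (v P) := by
  simp [IsWeight, z_mul_v]

theorem IsWeight.mul {k l : ℤ} {a b : Alg P} (ha : IsWeight k a) (hb : IsWeight l b) :
    IsWeight (k + l) (a * b) := by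
  unfold IsWeight at *
  have : z P * (a * b) - a * b * z P = (z P * a - a * z P) * b + a * (z P * b - b * z P) := by
    noncomm_ring
  rw [this, ha, hb]
  push_cast
  rw [add_smul, smul_mul_assoc, mul_smul_comm]

theorem isWeight_polyZ (R : ℂ[X]) : IsWeight 0 (polyZ P R) := by
  have : z P * polyZ P R = polyZ P R * z P := by
    rw [← polyZ_X, ← map_mul, ← map_mul, mul_comm]
  simp [IsWeight, this]

theorem isWeight_one : IsWeight 0 (1 : Alg P) := by simp [IsWeight]

theorem IsWeight.pow {k : ℤ} {a : Alg P} (ha : IsWeight k a) (m : ℕ) : IsWeight (m * k) (a ^ m) := by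
  induction m with
  | zero => simpa using isWeight_one
  | succ m ih =>
    rw [pow_succ]
    convert ih.mul ha using 1
    push_cast; ring

theorem IsWeight.polyZ_mul {k : ℤ} {a : Alg P} (ha : IsWeight k a) (R : ℂ[X]) :
    polyZ P R * a = a * polyZ P (shift k R) := by
  have hz : z P * a = a * (z P + algebraMap ℂ _ (k : ℂ)) := by
    have := sub_eq_iff_eq_add.1 ha
    rw [this, mul_add, ← Algebra.commutes, ← Algebra.smul_def, add_comm]
  induction R using Polynomial.induction_on' with
  | add p q hp hq => simp [add_mul, mul_add, hp, hq]
  | monomial n c =>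
    induction n with
    | zero => simp [Polynomial.monomial_zero_left, Algebra.commutes]
    | succ n ih =>
      rw [← Polynomial.monomial_mul_X, map_mul, map_mul, map_mul, polyZ_X, mul_assoc, hz,
        ← mul_assoc, ih, mul_assoc]
      simp

theorem IsWeight.mul_polyZ {k : ℤ} {a : Alg P} (ha : IsWeight k a) (R : ℂ[X]) :
    a * polyZ P R = polyZ P (shift (-k) R) * a := by
  rw [ha.polyZ_mul]; simp

/-- The weight vector of weight `k` in `𝒜_P`: `v ^ k` or `u ^ (-k)`. -/
def weightVec (P : ℂ[X]) (k : ℤ) : Alg P := v P ^ k.toNat * u P ^ (-k).toNat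

theorem isWeight_weightVec (k : ℤ) : IsWeight k (weightVec P k) := by
  have := (isWeight_v (P := P)).pow k.toNat |>.mul ((isWeight_u (P := P)).pow (-k).toNat)
  convert this using 1
  · omega
  · rfl

@[simp] theorem weightVec_zero : weightVec P 0 = 1 := by simp [weightVec]
@[simp] theorem weightVec_one : weightVec P 1 = v P := by simp [weightVec]
@[simp] theorem weightVec_neg_one : weightVec P (-1) = u P := by simp [weightVec]

theorem weightVec_natCast (k : ℕ) : weightVec P k = v P ^ k := by simp [weightVec]
theorem weightVec_neg_natCast (k : ℕ) : weightVec P (-k) = u P ^ k := by simp [weightVec]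

/-- The map `(R_k)_k ↦ ∑ R_k(z) w_k`. -/
def ofCoeffs (P : ℂ[X]) : (ℤ →₀ ℂ[X]) →ₗ[ℂ] Alg P :=
  Finsupp.lsum ℂ fun k => (LinearMap.mulRight ℂ (weightVec P k)).comp (polyZ P).toLinearMap

@[simp] theorem ofCoeffs_single (k : ℤ) (R : ℂ[X]) :
    ofCoeffs P (Finsupp.single k R) = polyZ P R * weightVec P k := by
  simp [ofCoeffs]

theorem ofCoeffs_apply (r : ℤ →₀ ℂ[X]) :
    ofCoeffs P r = ∑ k ∈ r.support, polyZ P (r k) * weightVec P k := by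
  simp [ofCoeffs, Finsupp.lsum_apply, Finsupp.sum]

theorem v_mul_weightVec (k : ℤ) : ∃ S, v P * weightVec P k = polyZ P S * weightVec P (k + 1) := by
  obtain ⟨m, rfl | rfl⟩ := k.eq_nat_or_neg
  · refine ⟨1, ?_⟩
    have := weightVec_natCast (P := P) (m + 1)
    push_cast at this
    rw [this, weightVec_natCast, pow_succ', map_one, one_mul]
  · cases m with
    | zero => exact ⟨1, by simp⟩
    | succ m =>
      refine ⟨shift (-(1 / 2)) P, ?_⟩
      have : -((m + 1 : ℕ) : ℤ) + 1 = -(m : ℤ) := by push_cast; ring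
      rw [this, weightVec_neg_natCast, weightVec_neg_natCast, pow_succ', ← mul_assoc, v_mul_u_eq]

theorem u_mul_weightVec (k : ℤ) : ∃ S, u P * weightVec P k = polyZ P S * weightVec P (k - 1) := by
  obtain ⟨m, rfl | rfl⟩ := k.eq_nat_or_neg
  · cases m with
    | zero => exact ⟨1, by simp⟩
    | succ m =>
      refine ⟨shift (1 / 2) P, ?_⟩
      have : ((m + 1 : ℕ) : ℤ) - 1 = (m : ℤ) := by push_cast; ring
      rw [this, weightVec_natCast, weightVec_natCast, pow_succ', ← mul_assoc, u_mul_v_eq]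
  · refine ⟨1, ?_⟩
    have := weightVec_neg_natCast (P := P) (m + 1)
    rw [show -((m + 1 : ℕ) : ℤ) = -(m : ℤ) - 1 by push_cast; ring] at this
    rw [this, weightVec_neg_natCast, pow_succ', map_one, one_mul]

/-- The range contains 1 and is stable under left multiplication by the generators: R(z) moves past
u or v at the cost of a shift, and u or v sends each weight vector to a ℂ[z]-multiple of the
neighbouring one. -/
theorem ofCoeffs_surjective : Function.Surjective (ofCoeffs P) := by
  have key : ∀ a b : Alg P, b ∈ LinearMap.range (ofCoeffs P) →
      a * b ∈ LinearMap.range (ofCoeffs P) := by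
    have gen : ∀ a : Alg P, (∀ k R, a * (polyZ P R * weightVec P k) ∈ LinearMap.range (ofCoeffs P)) →
        ∀ b ∈ LinearMap.range (ofCoeffs P), a * b ∈ LinearMap.range (ofCoeffs P) := by
      rintro a h _ ⟨r, rfl⟩
      rw [ofCoeffs_apply, Finset.mul_sum]
      exact Submodule.sum_mem _ fun k _ => h k (r k)
    intro a
    induction a using Alg.induction with
    | hc c => exact fun b hb => by rw [← Algebra.smul_def]; exact Submodule.smul_mem _ _ hb
    | hu =>
      refine gen _ fun k R => ?_
      obtain ⟨S, hS⟩ := u_mul_weightVec (P := P) k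
      rw [← mul_assoc, isWeight_u.mul_polyZ, mul_assoc, hS, ← mul_assoc, ← map_mul,
        ← ofCoeffs_single]
      exact LinearMap.mem_range_self _ _
    | hv =>
      refine gen _ fun k R => ?_
      obtain ⟨S, hS⟩ := v_mul_weightVec (P := P) k
      rw [← mul_assoc, isWeight_v.mul_polyZ, mul_assoc, hS, ← mul_assoc, ← map_mul,
        ← ofCoeffs_single]
      exact LinearMap.mem_range_self _ _
    | hz =>
      refine gen _ fun k R => ?_
      rw [← polyZ_X, ← mul_assoc, ← map_mul, ← ofCoeffs_single]
      exact LinearMap.mem_range_self _ _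
    | hadd a b ha hb => exact fun c hc => by rw [add_mul]; exact add_mem (ha c hc) (hb c hc)
    | hmul a b ha hb => exact fun c hc => by rw [mul_assoc]; exact ha _ (hb c hc)
  intro a
  have := key a 1 ⟨Finsupp.single 0 1, by simp⟩
  rwa [mul_one] at this

end

/-! ### Independence of the weight vectors, from a concrete representation. -/

noncomputable section
variable {P : ℂ[X]}

/-- The action of the generators of `𝒜_P` on `⨁ ℂ[x] e_k`. -/
def repGen (P : ℂ[X]) : Gen → Module.End ℂ (ℤ → ℂ[X])
  | Gen.u => LinearMap.pi fun k => (LinearMap.mulLeft ℂ (shift (1 / 2) P)).comp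
      ((shift 1).toLinearMap.comp (LinearMap.proj (k + 1)))
  | Gen.v => LinearMap.pi fun k => (shift (-1)).toLinearMap.comp (LinearMap.proj (k - 1))
  | Gen.z => LinearMap.pi fun k => (LinearMap.mulLeft ℂ Polynomial.X).comp (LinearMap.proj k)

theorem repGen_u_apply (f : ℤ → ℂ[X]) (k : ℤ) :
    repGen P Gen.u f k = shift (1 / 2) P * shift 1 (f (k + 1)) := rfl

theorem repGen_v_apply (f : ℤ → ℂ[X]) (k : ℤ) :
    repGen P Gen.v f k = shift (-1) (f (k - 1)) := rfl

theorem repGen_z_apply (f : ℤ → ℂ[X]) (k : ℤ) :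
    repGen P Gen.z f k = Polynomial.X * f k := rfl

theorem aeval_repGen_z_add (c : ℂ) (R : ℂ[X]) (f : ℤ → ℂ[X]) (k : ℤ) :
    Polynomial.aeval (repGen P Gen.z + algebraMap ℂ _ c) R f k = shift c R * f k := by
  induction R using Polynomial.induction_on' generalizing f with
  | add p q hp hq => simp [hp, hq, add_mul]
  | monomial n a =>
    induction n generalizing f with
    | zero => simp [Polynomial.monomial_zero_left, Polynomial.smul_eq_C_mul]
    | succ n ih =>
      rw [← Polynomial.monomial_mul_X, map_mul, Module.End.mul_apply, ih, map_mul]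
      simp [repGen_z_apply, Polynomial.smul_eq_C_mul]
      ring

theorem repGen_rel ⦃a b : FreeAlgebra ℂ Gen⦄ (h : Rel P a b) :
    FreeAlgebra.lift ℂ (repGen P) a = FreeAlgebra.lift ℂ (repGen P) b := by
  cases h with
  | zu =>
    ext1 f; funext k
    simp [repGen_z_apply, repGen_u_apply]
    ring
  | zv =>
    ext1 f; funext k
    simp [repGen_z_apply, repGen_v_apply]
    ring
  | vu =>
    rw [← Polynomial.aeval_algHom_apply, map_sub, AlgHom.commutes, sub_eq_add_neg, ← map_neg]
    ext1 f; funext k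
    rw [FreeAlgebra.lift_ι_apply, aeval_repGen_z_add]
    simp only [map_mul, FreeAlgebra.lift_ι_apply, Module.End.mul_apply, repGen_v_apply,
      repGen_u_apply, shift_shift, sub_add_cancel]
    norm_num
  | uv =>
    rw [← Polynomial.aeval_algHom_apply, map_add, AlgHom.commutes]
    ext1 f; funext k
    rw [FreeAlgebra.lift_ι_apply, aeval_repGen_z_add]
    simp only [map_mul, FreeAlgebra.lift_ι_apply, Module.End.mul_apply, repGen_v_apply,
      repGen_u_apply, shift_shift, add_sub_cancel_right]
    norm_num

/-- The representation of `𝒜_P` on `⨁ ℂ[x] e_k`. -/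
def rep (P : ℂ[X]) : Alg P →ₐ[ℂ] Module.End ℂ (ℤ → ℂ[X]) :=
  RingQuot.liftAlgHom ℂ (s := Rel P) ⟨FreeAlgebra.lift ℂ (repGen P), repGen_rel⟩

theorem rep_gen (x : Gen) : rep P (gen P x) = repGen P x :=
  (RingQuot.liftAlgHom_mkAlgHom_apply ℂ (FreeAlgebra.lift ℂ (repGen P)) repGen_rel
    (FreeAlgebra.ι ℂ x)).trans (FreeAlgebra.lift_ι_apply _ _)

theorem rep_u : rep P (u P) = repGen P Gen.u := rep_gen _
theorem rep_v : rep P (v P) = repGen P Gen.v := rep_gen _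
theorem rep_z : rep P (z P) = repGen P Gen.z := rep_gen _

theorem rep_polyZ_apply (R : ℂ[X]) (f : ℤ → ℂ[X]) (k : ℤ) :
    rep P (polyZ P R) f k = R * f k := by
  have := aeval_repGen_z_add (P := P) 0 R f k
  rw [map_zero, add_zero, shift_zero] at this
  rw [← this, polyZ, ← Polynomial.aeval_algHom_apply, rep_z]

/-- The `k`-th component of `a` applied to the cyclic vector. -/
def component (P : ℂ[X]) (k : ℤ) : Alg P →ₗ[ℂ] ℂ[X] :=
  (LinearMap.proj k).comp
    ((LinearMap.applyₗ (R := ℂ) (Pi.single (0 : ℤ) (1 : ℂ[X]))).comp (rep P).toLinearMap)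

theorem component_apply (k : ℤ) (a : Alg P) :
    component P k a = rep P a (Pi.single (0 : ℤ) (1 : ℂ[X])) k := rfl

theorem component_polyZ_mul (k : ℤ) (R : ℂ[X]) (a : Alg P) :
    component P k (polyZ P R * a) = R * component P k a := by
  rw [component_apply, map_mul, Module.End.mul_apply, rep_polyZ_apply, component_apply]

theorem component_v_pow (m : ℕ) (k : ℤ) :
    component P k (v P ^ m) = if k = m then 1 else 0 := by
  induction m generalizing k with
  | zero => simp [component_apply, Pi.single_apply]
  | succ m ih =>
    rw [component_apply, pow_succ', map_mul, Module.End.mul_apply, rep_v, repGen_v_apply,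
      ← component_apply, ih]
    have : k - 1 = m ↔ k = ((m + 1 : ℕ) : ℤ) := by push_cast; omega
    simp only [this]
    split_ifs <;> simp

theorem component_u_pow (hP : P ≠ 0) (m : ℕ) :
    ∃ c : ℂ[X], c ≠ 0 ∧ ∀ k, component P k (u P ^ m) = if k = -(m : ℤ) then c else 0 := by
  induction m with
  | zero => exact ⟨1, one_ne_zero, fun k => by simp [component_apply, Pi.single_apply]⟩
  | succ m ih =>
    obtain ⟨c, hc, h⟩ := ih
    refine ⟨shift (1 / 2) P * shift 1 c, mul_ne_zero (by simpa using hP) (by simpa using hc),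
      fun k => ?_⟩
    rw [component_apply, pow_succ', map_mul, Module.End.mul_apply, rep_u, repGen_u_apply,
      ← component_apply, h]
    have : k + 1 = -(m : ℤ) ↔ k = -((m + 1 : ℕ) : ℤ) := by push_cast; omega
    simp only [this]
    split_ifs <;> simp

/-- Independence over ℂ[z] comes from here: applied to the cyclic vector, distinct weight vectors
land in distinct coordinates. For negative k the nonzero entry is a product of shifts of P. -/
theorem component_weightVec (hP : P ≠ 0) (k : ℤ) :
    ∃ c : ℂ[X], c ≠ 0 ∧ ∀ l, component P l (weightVec P k) = if l = k then c else 0 := by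
  obtain ⟨m, rfl | rfl⟩ := k.eq_nat_or_neg
  · exact ⟨1, one_ne_zero, fun l => by rw [weightVec_natCast, component_v_pow]⟩
  · rw [weightVec_neg_natCast]
    exact component_u_pow hP m

theorem component_polyZ_mul_weightVec_of_ne (hP : P ≠ 0) {k l : ℤ} (h : l ≠ k) (R : ℂ[X]) :
    component P l (polyZ P R * weightVec P k) = 0 := by
  obtain ⟨c, -, hc⟩ := component_weightVec hP k
  rw [component_polyZ_mul, hc, if_neg h, mul_zero]

@[simp] theorem component_zero_polyZ (R : ℂ[X]) : component P 0 (polyZ P R) = R := by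
  rw [component_apply, rep_polyZ_apply]
  simp

theorem polyZ_injective : Function.Injective (polyZ P) :=
  Function.LeftInverse.injective (g := component P 0) component_zero_polyZ

theorem polyZ_mul_weightVec_ne_zero (hP : P ≠ 0) {R : ℂ[X]} (hR : R ≠ 0) (k : ℤ) :
    polyZ P R * weightVec P k ≠ 0 := by
  intro h
  obtain ⟨c, hc, hk⟩ := component_weightVec hP k
  have := congrArg (component P k) h
  rw [component_polyZ_mul, hk, if_pos rfl, map_zero] at this
  exact mul_ne_zero hR hc this

theorem component_ofCoeffs (hP : P ≠ 0) (r : ℤ →₀ ℂ[X]) (k : ℤ) :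
    component P k (ofCoeffs P r) = r k * component P k (weightVec P k) := by
  rw [ofCoeffs_apply, map_sum, Finset.sum_eq_single k]
  · exact component_polyZ_mul _ _ _
  · exact fun l _ hl => component_polyZ_mul_weightVec_of_ne hP hl.symm _
  · intro hk
    rw [Finsupp.notMem_support_iff.1 hk]
    simp

theorem component_mul_z (hP : P ≠ 0) (a : Alg P) (k : ℤ) :
    component P k (a * z P) = (Polynomial.X - Polynomial.C (k : ℂ)) * component P k a := by
  obtain ⟨r, rfl⟩ := ofCoeffs_surjective a
  induction r using Finsupp.induction_linear with
  | zero => simp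
  | add r s hr hs => simp [add_mul, mul_add, hr, hs]
  | single l R =>
    rw [ofCoeffs_single, mul_assoc, ← polyZ_X, (isWeight_weightVec l).mul_polyZ, ← mul_assoc,
      ← map_mul]
    by_cases h : k = l
    · subst h
      simp only [component_polyZ_mul, shift_X, map_neg]
      ring
    · rw [component_polyZ_mul_weightVec_of_ne hP h, component_polyZ_mul_weightVec_of_ne hP h,
        mul_zero]

/-- On the l-th coordinate, left multiplication by z is X and right multiplication is X - l, so the
commutator with z acts there as the scalar l. -/
theorem IsWeight.component_eq_zero (hP : P ≠ 0) {k l : ℤ} {a : Alg P} (ha : IsWeight k a)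
    (h : l ≠ k) : component P l a = 0 := by
  have := congrArg (component P l) ha
  rw [map_sub, component_mul_z hP, ← polyZ_X, component_polyZ_mul, map_smul, ← sub_mul,
    Polynomial.smul_eq_C_mul, ← sub_eq_zero, ← sub_mul, sub_sub_cancel, ← map_sub] at this
  refine (mul_eq_zero.1 this).resolve_left ?_
  rw [Polynomial.C_eq_zero, sub_eq_zero]
  exact_mod_cast h

end

/-! ### Twisted traces as functionals on ℂ[x]. -/

noncomputable section
variable {P : ℂ[X]} {t : ℂˣ}

theorem twist_u : twist P t (u P) = ((t⁻¹ : ℂˣ) : ℂ) • u P := twist_gen P t Gen.u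
theorem twist_v : twist P t (v P) = (t : ℂ) • v P := twist_gen P t Gen.v
theorem twist_z : twist P t (z P) = z P := twist_gen P t Gen.z

section Trace

variable {T' : Alg P →ₗ[ℂ] ℂ}

/-- Since g_t fixes z, the trace kills the commutator [z, a] = ka. -/
theorem IsTwistedTrace.eq_zero_of_isWeight (hT : IsTwistedTrace P t T') {k : ℤ} (hk : k ≠ 0)
    {a : Alg P} (ha : IsWeight k a) : T' a = 0 := by
  have h := hT (z P) a
  rw [twist_z, ← sub_eq_zero, ← map_sub, ha, map_smul, smul_eq_zero] at h
  exact h.resolve_left (by exact_mod_cast hk)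

theorem IsTwistedTrace.eq_component (hP : P ≠ 0) (hT : IsTwistedTrace P t T') (a : Alg P) :
    T' a = T' (polyZ P (component P 0 a)) := by
  obtain ⟨r, rfl⟩ := ofCoeffs_surjective a
  induction r using Finsupp.induction_linear with
  | zero => simp
  | add r s hr hs => rw [map_add, map_add, hr, hs, map_add, map_add, map_add]
  | single l R =>
    rw [ofCoeffs_single]
    by_cases h : l = 0
    · subst h; simp
    · rw [component_polyZ_mul_weightVec_of_ne hP (Ne.symm h), map_zero, map_zero]
      refine hT.eq_zero_of_isWeight h ?_
      simpa using (isWeight_polyZ R).mul (isWeight_weightVec l)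

theorem IsTwistedTrace.mul_u (hT : IsTwistedTrace P t T') (a : Alg P) :
    T' (a * u P) = t * T' (u P * a) := by
  rw [hT (u P) a, twist_u, mul_smul_comm, map_smul, smul_eq_mul, Units.mul_inv_cancel_left]

theorem IsTwistedTrace.mul_v (hT : IsTwistedTrace P t T') (a : Alg P) :
    T' (v P * a) = t * T' (a * v P) := by
  rw [hT (v P) a, twist_v, mul_smul_comm, map_smul, smul_eq_mul]

theorem IsTwistedTrace.shift_eq (hT : IsTwistedTrace P t T') (S : ℂ[X]) :
    T' (polyZ P (shift (-(1 / 2)) (S * P))) = t * T' (polyZ P (shift (1 / 2) (S * P))) := by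
  have h := hT.mul_v (polyZ P (shift (1 / 2) S) * u P)
  rw [mul_assoc (polyZ P _), u_mul_v_eq, ← map_mul, ← map_mul, ← mul_assoc, isWeight_v.mul_polyZ,
    mul_assoc, v_mul_u_eq, ← map_mul, shift_shift] at h
  rw [← h, map_mul]
  norm_num

/-- The functional `R(z) ↦ T R`, extended by zero to nonzero weights. -/
def extend (P : ℂ[X]) (T : ℂ[X] →ₗ[ℂ] ℂ) : Alg P →ₗ[ℂ] ℂ := T.comp (component P 0)

@[simp] theorem extend_polyZ (T : ℂ[X] →ₗ[ℂ] ℂ) (R : ℂ[X]) : extend P T (polyZ P R) = T R := by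
  simp [extend]

theorem extend_eq_zero (hP : P ≠ 0) (T : ℂ[X] →ₗ[ℂ] ℂ) {k : ℤ} (hk : k ≠ 0) {a : Alg P}
    (ha : IsWeight k a) : extend P T a = 0 := by
  simp [extend, ha.component_eq_zero hP hk.symm]

/-- The trace identity, for all b at once, is stable under sums and products in a, so only
generators matter. -/
theorem isTwistedTrace_extend (hP : P ≠ 0) {T : ℂ[X] →ₗ[ℂ] ℂ}
    (hT : ∀ S, T (shift (-(1 / 2)) (S * P)) = t * T (shift (1 / 2) (S * P))) :
    IsTwistedTrace P t (extend P T) := by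
  have red : ∀ a : Alg P, (∀ (k : ℤ) (R : ℂ[X]), extend P T (a * (polyZ P R * weightVec P k))
      = extend P T (polyZ P R * weightVec P k * twist P t a)) →
      ∀ b, extend P T (a * b) = extend P T (b * twist P t a) := by
    intro a h b
    obtain ⟨r, rfl⟩ := ofCoeffs_surjective b
    rw [ofCoeffs_apply, Finset.mul_sum, Finset.sum_mul, map_sum, map_sum]
    exact Finset.sum_congr rfl fun k _ => h k (r k)
  have hw : ∀ (k : ℤ) (R : ℂ[X]), IsWeight k (polyZ P R * weightVec P k) := fun k R => by
    simpa using (isWeight_polyZ R).mul (isWeight_weightVec k)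
  intro a
  induction a using Alg.induction with
  | hc c =>
    intro b
    rw [AlgHom.commutes, Algebra.commutes]
  | hu =>
    refine red _ fun k R => ?_
    rw [twist_u, mul_smul_comm, map_smul]
    -- Both products have weight k - 1, so only k = 1 can contribute; there the identity is the
    -- equation `hT`.
    by_cases hk : k = 1
    · subst hk
      have h := hT (shift (1 / 2) R)
      rw [weightVec_one, ← mul_assoc, isWeight_u.mul_polyZ, mul_assoc, mul_assoc, u_mul_v_eq,
        v_mul_u_eq, ← map_mul, ← map_mul, extend_polyZ, extend_polyZ]
      rw [map_mul (shift _), map_mul (shift _), shift_shift, shift_shift, neg_add_cancel, shift_zero] at h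
      rw [h, smul_eq_mul, Units.inv_mul_cancel_left]
      norm_num
    · rw [extend_eq_zero hP T _ (isWeight_u.mul (hw k R)),
        extend_eq_zero hP T _ ((hw k R).mul isWeight_u), smul_zero] <;> omega
  | hv =>
    refine red _ fun k R => ?_
    rw [twist_v, mul_smul_comm, map_smul]
    by_cases hk : k = -1
    · subst hk
      have h := hT (shift (-(1 / 2)) R)
      rw [weightVec_neg_one, ← mul_assoc, isWeight_v.mul_polyZ, mul_assoc, mul_assoc, u_mul_v_eq,
        v_mul_u_eq, ← map_mul, ← map_mul, extend_polyZ, extend_polyZ]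
      rw [map_mul (shift _), map_mul (shift _), shift_shift, shift_shift, add_neg_cancel, shift_zero] at h
      rw [smul_eq_mul, ← h]
      norm_num
    · rw [extend_eq_zero hP T _ (isWeight_v.mul (hw k R)),
        extend_eq_zero hP T _ ((hw k R).mul isWeight_v), smul_zero] <;> omega
  | hz =>
    refine red _ fun k R => ?_
    rw [twist_z]
    by_cases hk : k = 0
    · subst hk
      rw [weightVec_zero, mul_one, ← polyZ_X, ← map_mul, ← map_mul, mul_comm]
    · rw [← sub_eq_zero, ← map_sub, hw k R, map_smul, extend_eq_zero hP T hk (hw k R), smul_zero]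
  | hadd a a' h h' =>
    intro b
    rw [add_mul, map_add, map_add, mul_add, map_add, h, h']
  | hmul a a' h h' =>
    intro b
    rw [mul_assoc, h, mul_assoc, h', map_mul (twist P t), mul_assoc]

end Trace

/-! ### Consequences of having a conjugation. -/

section Conjugation

variable {lam lamStar : ℂ} {ρ : Alg P ≃+* Alg P}

theorem IsConjugation.map_algebraMap (hρ : IsConjugation P lam lamStar ρ) (c : ℂ) :
    ρ (algebraMap ℂ _ c) = algebraMap ℂ _ ((starRingEnd ℂ) c) := by
  rw [Algebra.algebraMap_eq_smul_one, hρ.antilinear, map_one, ← Algebra.algebraMap_eq_smul_one]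

theorem IsConjugation.map_polyZ (hρ : IsConjugation P lam lamStar ρ) (R : ℂ[X]) :
    ρ (polyZ P R) = polyZ P (conjNeg R) := by
  have : ρ.toRingHom.comp (polyZ P).toRingHom = (polyZ P).toRingHom.comp conjNeg := by
    apply Polynomial.ringHom_ext
    · intro c
      simp [hρ.map_algebraMap]
    · simp [hρ.map_z]
  exact DFunLike.congr_fun this R

theorem IsConjugation.isWeight (hρ : IsConjugation P lam lamStar ρ) {k : ℤ} {a : Alg P}
    (ha : IsWeight k a) : IsWeight (-k) (ρ a) := by
  have := congrArg ρ ha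
  rw [map_sub, map_mul, map_mul, hρ.map_z, hρ.antilinear, map_intCast] at this
  unfold IsWeight
  rw [Int.cast_neg, neg_smul, ← this]
  noncomm_ring

/-- Apply ρ to uv = P(z + 1/2): the left side becomes a multiple of vu = P(z - 1/2), the right side
P*(z - 1/2). -/
theorem IsConjugation.conjNeg_eq (hρ : IsConjugation P lam lamStar ρ) :
    conjNeg P = (lam * lamStar) • P := by
  have h := congrArg ρ (u_mul_v_eq (P := P))
  rw [map_mul, hρ.map_u, hρ.map_v, hρ.map_polyZ, smul_mul_smul_comm, v_mul_u_eq, conjNeg_shift,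
    ← map_smul] at h
  have h' := polyZ_injective h
  have e : -(starRingEnd ℂ) (1 / 2 : ℂ) = -(1 / 2) := by
    simp [Complex.conj_ofNat]
  rw [e, ← map_smul] at h'
  rw [mul_comm lam, shift_injective _ h']

theorem v_ne_zero (hP : P ≠ 0) : v P ≠ 0 := by
  simpa using polyZ_mul_weightVec_ne_zero hP one_ne_zero 1

theorem IsConjugation.conj_mul (hP : P ≠ 0) (hρ : IsConjugation P lam lamStar ρ)
    (hρt : ∀ a, ρ (ρ a) = twist P t a) : (starRingEnd ℂ) lam * lamStar = t := by
  have h := hρt (v P)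
  rw [hρ.map_v, hρ.antilinear, hρ.map_u, twist_v, smul_smul, ← sub_eq_zero, ← sub_smul,
    smul_eq_zero] at h
  exact sub_eq_zero.1 (h.resolve_right (v_ne_zero hP))

theorem IsConjugation.sq_eq_twist (hρ : IsConjugation P lam lamStar ρ)
    (ht : (starRingEnd ℂ) lam * lamStar = t) (ht' : (starRingEnd ℂ) lamStar * lam = (t⁻¹ : ℂˣ))
    (a : Alg P) : ρ (ρ a) = twist P t a := by
  induction a using Alg.induction with
  | hc c => rw [hρ.map_algebraMap, hρ.map_algebraMap, AlgHom.commutes, Complex.conj_conj]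
  | hu => rw [hρ.map_u, hρ.antilinear, hρ.map_v, smul_smul, ht', twist_u]
  | hv => rw [hρ.map_v, hρ.antilinear, hρ.map_u, smul_smul, ht, twist_v]
  | hz => rw [hρ.map_z, map_neg, hρ.map_z, neg_neg, twist_z]
  | hadd a b ha hb => simp [ha, hb]
  | hmul a b ha hb => simp [ha, hb]

end Conjugation

end

/-! ### Positivity on the algebra reduced to weights 0 and 1. -/

noncomputable section
variable {P : ℂ[X]} {t : ℂˣ} {lam lamStar : ℂ} {ρ : Alg P ≃+* Alg P}

theorem conjNeg_shift_half (R : ℂ[X]) :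
    conjNeg (shift (1 / 2) R) = shift (-(1 / 2)) (conjNeg R) := by
  rw [conjNeg_shift]
  simp [Complex.conj_ofNat]

theorem conjNeg_shift_neg_half (R : ℂ[X]) :
    conjNeg (shift (-(1 / 2)) R) = shift (1 / 2) (conjNeg R) := by
  rw [conjNeg_shift]
  simp [Complex.conj_ofNat]

/-- The conditions on a functional `T` on `ℂ[x]` which characterise positive traces on `𝒜_P`. -/
structure IsPositiveFunctional (P : ℂ[X]) (t : ℂ) (lam : ℂ) (T : ℂ[X] →ₗ[ℂ] ℂ) : Prop where
  trace : ∀ S, T (shift (-(1 / 2)) (S * P)) = t * T (shift (1 / 2) (S * P))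
  conj : ∀ R, T (conjNeg R) = (starRingEnd ℂ) (T R)
  pos : ∀ R, R ≠ 0 → 0 < (T (R * conjNeg R)).re
  pos_shift : ∀ R, R ≠ 0 → 0 < (lam * T (shift (-(1 / 2)) (R * conjNeg R * P))).re

section Forms

variable {T' : Alg P →ₗ[ℂ] ℂ}

theorem pairing_polyZ (hρ : IsConjugation P lam lamStar ρ) (R : ℂ[X]) :
    T' (polyZ P R * ρ (polyZ P R)) = T' (polyZ P (R * conjNeg R)) := by
  rw [hρ.map_polyZ, map_mul (polyZ P)]

theorem pairing_polyZ_mul_v (hρ : IsConjugation P lam lamStar ρ) (R : ℂ[X]) :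
    T' (polyZ P (shift (-(1 / 2)) R) * v P * ρ (polyZ P (shift (-(1 / 2)) R) * v P))
      = lam * T' (polyZ P (shift (-(1 / 2)) (R * conjNeg R * P))) := by
  rw [map_mul ρ, hρ.map_polyZ, hρ.map_v, conjNeg_shift_neg_half, mul_smul_comm, mul_smul_comm,
    map_smul, smul_eq_mul, mul_assoc, ← mul_assoc (v P), isWeight_v.mul_polyZ, mul_assoc,
    v_mul_u_eq, ← map_mul, ← map_mul, shift_shift, map_mul (shift _), map_mul (shift _), mul_assoc]
  norm_num

/-- The outer v becomes u under ρ and is cycled to the front by the trace. With b of weight k this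
relates weight k + 2 to weight k, since uv is a polynomial in z. -/
theorem pairing_v_mul_mul_v (hρ : IsConjugation P lam lamStar ρ) (hT : IsTwistedTrace P t T')
    (ht : (starRingEnd ℂ) lam * lamStar = t) (b : Alg P) :
    T' (v P * b * v P * ρ (v P * b * v P))
      = (Complex.normSq lam : ℂ) * T' (u P * v P * b * ρ (u P * v P * b)) := by
  simp only [map_mul ρ, hρ.map_v, hρ.map_u, smul_mul_assoc, mul_smul_comm, smul_smul, map_smul,
    smul_eq_mul, ← mul_assoc]
  rw [hT.mul_u]
  simp only [← mul_assoc]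
  rw [← Complex.mul_conj, ← ht]
  ring

theorem pairing_u_mul_mul_u (hρ : IsConjugation P lam lamStar ρ) (hT : IsTwistedTrace P t T')
    (ht : (starRingEnd ℂ) lam * lamStar = t) (b : Alg P) :
    T' (v P * u P * b * ρ (v P * u P * b))
      = (Complex.normSq lam : ℂ) * T' (u P * b * u P * ρ (u P * b * u P)) := by
  simp only [map_mul ρ, hρ.map_v, hρ.map_u, smul_mul_assoc, mul_smul_comm, smul_smul, map_smul,
    smul_eq_mul]
  rw [mul_assoc (v P), mul_assoc (v P), hT.mul_v]
  simp only [← mul_assoc]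
  rw [← Complex.mul_conj, ← ht]
  ring

theorem pairing_mul_v (hρ : IsConjugation P lam lamStar ρ) (hT : IsTwistedTrace P t T')
    (ht : (starRingEnd ℂ) lam * lamStar = t) (b : Alg P) :
    T' (b * v P * ρ (b * v P)) = (Complex.normSq lam : ℂ) * T' (u P * b * ρ (u P * b)) := by
  simp only [map_mul ρ, hρ.map_v, hρ.map_u, smul_mul_assoc, mul_smul_comm, map_smul,
    smul_eq_mul, ← mul_assoc]
  rw [hT.mul_u]
  simp only [← mul_assoc]
  rw [← Complex.mul_conj, ← ht]
  ring

theorem pairing_v_pow_pos (hP : P ≠ 0) (hρ : IsConjugation P lam lamStar ρ) (hlam : lam ≠ 0)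
    (hT : IsTwistedTrace P t T') (ht : (starRingEnd ℂ) lam * lamStar = t)
    (h0 : ∀ R, R ≠ 0 → 0 < (T' (polyZ P (R * conjNeg R))).re)
    (h1 : ∀ R, R ≠ 0 → 0 < (lam * T' (polyZ P (shift (-(1 / 2)) (R * conjNeg R * P)))).re)
    (k : ℕ) {R : ℂ[X]} (hR : R ≠ 0) :
    0 < (T' (polyZ P R * v P ^ k * ρ (polyZ P R * v P ^ k))).re := by
  induction k using Nat.strong_induction_on generalizing R with
  | _ k ih =>
    match k with
    | 0 => simpa only [pow_zero, mul_one, pairing_polyZ hρ] using h0 R hR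
    | 1 =>
      have := h1 (shift (1 / 2) R) (by simpa using hR)
      rw [← pairing_polyZ_mul_v hρ, shift_shift, neg_add_cancel, shift_zero] at this
      rwa [pow_one]
    | k + 2 =>
      have e : polyZ P R * v P ^ (k + 2) = v P * (polyZ P (shift 1 R) * v P ^ k) * v P := by
        rw [← mul_assoc, isWeight_v.mul_polyZ, shift_shift, mul_assoc, mul_assoc,
          ← pow_succ, ← pow_succ']
        simp
      rw [e, pairing_v_mul_mul_v hρ hT ht, ← mul_assoc, u_mul_v_eq, ← map_mul,
        Complex.re_ofReal_mul]
      exact mul_pos (Complex.normSq_pos.2 hlam)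
        (ih k (by omega) (mul_ne_zero (by simpa using hP) (by simpa using hR)))

theorem pairing_u_pow_pos (hP : P ≠ 0) (hρ : IsConjugation P lam lamStar ρ) (hlam : lam ≠ 0)
    (hT : IsTwistedTrace P t T') (ht : (starRingEnd ℂ) lam * lamStar = t)
    (h0 : ∀ R, R ≠ 0 → 0 < (T' (polyZ P (R * conjNeg R))).re)
    (h1 : ∀ R, R ≠ 0 → 0 < (lam * T' (polyZ P (shift (-(1 / 2)) (R * conjNeg R * P)))).re)
    (k : ℕ) {R : ℂ[X]} (hR : R ≠ 0) :
    0 < (T' (polyZ P R * u P ^ k * ρ (polyZ P R * u P ^ k))).re := by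
  induction k using Nat.strong_induction_on generalizing R with
  | _ k ih =>
    match k with
    | 0 => simpa only [pow_zero, mul_one, pairing_polyZ hρ] using h0 R hR
    | 1 =>
      have := pairing_v_pow_pos hP hρ hlam hT ht h0 h1 1 (R := shift (-1) R) (by simpa using hR)
      rw [pow_one, pairing_mul_v hρ hT ht, Complex.re_ofReal_mul, isWeight_u.mul_polyZ,
        shift_shift] at this
      simpa using pos_of_mul_pos_right this (Complex.normSq_nonneg _)
    | k + 2 =>
      have e : polyZ P R * u P ^ (k + 2) = u P * (polyZ P (shift (-1) R) * u P ^ k) * u P := by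
        rw [← mul_assoc, isWeight_u.mul_polyZ, shift_shift, mul_assoc, mul_assoc,
          ← pow_succ, ← pow_succ']
        simp
      have := ih k (by omega) (R := shift (-(1 / 2)) P * shift (-1) R)
        (mul_ne_zero (by simpa using hP) (by simpa using hR))
      rw [map_mul (polyZ P), ← v_mul_u_eq, mul_assoc (v P * u P), pairing_u_mul_mul_u hρ hT ht, ← e,
        Complex.re_ofReal_mul] at this
      exact pos_of_mul_pos_right this (Complex.normSq_nonneg _)

/-- Since ρ negates weights and T' vanishes off weight 0, distinct weight components are orthogonal
and the diagonal terms suffice. -/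
theorem pairing_pos (hP : P ≠ 0) (hρ : IsConjugation P lam lamStar ρ) (hlam : lam ≠ 0)
    (hT : IsTwistedTrace P t T') (ht : (starRingEnd ℂ) lam * lamStar = t)
    (h0 : ∀ R, R ≠ 0 → 0 < (T' (polyZ P (R * conjNeg R))).re)
    (h1 : ∀ R, R ≠ 0 → 0 < (lam * T' (polyZ P (shift (-(1 / 2)) (R * conjNeg R * P)))).re)
    {a : Alg P} (ha : a ≠ 0) : 0 < (T' (a * ρ a)).re := by
  obtain ⟨r, rfl⟩ := ofCoeffs_surjective a
  have hw : ∀ (k : ℤ) (R : ℂ[X]), IsWeight k (polyZ P R * weightVec P k) := fun k R => by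
    simpa using (isWeight_polyZ R).mul (isWeight_weightVec k)
  have e : T' (ofCoeffs P r * ρ (ofCoeffs P r)) = ∑ k ∈ r.support,
      T' (polyZ P (r k) * weightVec P k * ρ (polyZ P (r k) * weightVec P k)) := by
    rw [ofCoeffs_apply, map_sum ρ, Finset.sum_mul, map_sum]
    refine Finset.sum_congr rfl fun k hk => ?_
    rw [Finset.mul_sum, map_sum]
    refine Finset.sum_eq_single_of_mem k hk fun l _ hl => ?_
    exact hT.eq_zero_of_isWeight (by omega) ((hw k _).mul (hρ.isWeight (hw l _)))
  rw [e, Complex.re_sum]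
  refine Finset.sum_pos (fun k hk => ?_) ?_
  · rw [Finsupp.mem_support_iff] at hk
    obtain ⟨m, rfl | rfl⟩ := k.eq_nat_or_neg
    · rw [weightVec_natCast]
      exact pairing_v_pow_pos hP hρ hlam hT ht h0 h1 m hk
    · rw [weightVec_neg_natCast]
      exact pairing_u_pow_pos hP hρ hlam hT ht h0 h1 m hk
  · rw [Finsupp.support_nonempty_iff]
    rintro rfl
    exact ha (map_zero _)

theorem extend_conjugation (hP : P ≠ 0) (hρ : IsConjugation P lam lamStar ρ)
    {T : ℂ[X] →ₗ[ℂ] ℂ} (hT : ∀ R, T (conjNeg R) = (starRingEnd ℂ) (T R)) (a : Alg P) :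
    extend P T (ρ a) = (starRingEnd ℂ) (extend P T a) := by
  obtain ⟨r, rfl⟩ := ofCoeffs_surjective a
  induction r using Finsupp.induction_linear with
  | zero => simp
  | add r s hr hs => simp only [map_add, hr, hs]
  | single l R =>
    rw [ofCoeffs_single]
    by_cases h : l = 0
    · subst h
      simp [hρ.map_polyZ, hT]
    · have hw : IsWeight l (polyZ P R * weightVec P l) := by
        simpa using (isWeight_polyZ R).mul (isWeight_weightVec l)
      rw [extend_eq_zero hP T h hw, extend_eq_zero hP T (by omega) (hρ.isWeight hw), map_zero]

theorem isPositiveTrace_iff (hP : P ≠ 0) (hρ : IsConjugation P lam lamStar ρ) (hlam : lam ≠ 0)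
    (hρt : ∀ a, ρ (ρ a) = twist P t a) (T : ℂ[X] →ₗ[ℂ] ℂ) :
    IsPositiveTrace P t ρ T ↔ IsPositiveFunctional P t lam T := by
  constructor
  · rintro ⟨T', hT', hres, herm, hpos⟩
    change ∀ R, T' (polyZ P R) = T R at hres
    refine ⟨fun S => ?_, fun R => ?_, fun R hR => ?_, fun R hR => ?_⟩
    · rw [← hres, ← hres, hT'.shift_eq]
    · have := herm (polyZ P R) 1
      simpa only [one_mul, map_one, mul_one, hρ.map_polyZ, hres] using this
    · have := hpos (polyZ P R) ((map_ne_zero_iff _ polyZ_injective).2 hR)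
      beta_reduce at this
      rwa [pairing_polyZ hρ, hres] at this
    · have := hpos (polyZ P (shift (-(1 / 2)) R) * v P) (by
        simpa using polyZ_mul_weightVec_ne_zero hP (R := shift (-(1 / 2)) R)
          (by simpa using hR) 1)
      beta_reduce at this
      rwa [pairing_polyZ_mul_v hρ, hres] at this
  · intro h
    have hT := isTwistedTrace_extend hP h.trace
    refine ⟨extend P T, hT, extend_polyZ T, fun a b => ?_, fun a ha => ?_⟩
    · rw [← extend_conjugation hP hρ h.conj, map_mul, hρt, ← hT]
    · refine pairing_pos hP hρ hlam hT (hρ.conj_mul hP hρt) ?_ ?_ ha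
      · simpa only [extend_polyZ] using h.pos
      · simpa only [extend_polyZ] using h.pos_shift

end Forms

/-! ### Invariant forms correspond to positive traces. -/

section Cone

variable {B : Alg P →ₗ[ℂ] Alg P →ₛₗ[starRingEnd ℂ] ℂ}

theorem apply_eq_of_mem_positiveCone (hB : B ∈ positiveCone P ρ) (a b : Alg P) :
    B a b = B (a * ρ b) 1 := by
  rw [hB.2, mul_one]

/-- With b = ρ(c), hermiticity and invariance give (aρ(c), 1) = (a, c) = (1, cρ(a)) = (ρ(c)ρ²(a),
1), and ρ² = g_t. -/
theorem isTwistedTrace_of_mem_positiveCone (hρt : ∀ a, ρ (ρ a) = twist P t a)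
    (hB : B ∈ positiveCone P ρ) : IsTwistedTrace P t (B.flip 1) := by
  intro a b
  obtain ⟨c, rfl⟩ := ρ.surjective b
  rw [← hρt, ← map_mul, LinearMap.flip_apply, LinearMap.flip_apply,
    ← apply_eq_of_mem_positiveCone hB, ← one_mul (ρ (c * ρ a)),
    ← apply_eq_of_mem_positiveCone hB]
  have h1 : B a c = (starRingEnd ℂ) (B c a) := hB.1.1 c a
  have h2 : B 1 (c * ρ a) = (starRingEnd ℂ) (B (c * ρ a) 1) := hB.1.1 (c * ρ a) 1
  rw [h1, h2, apply_eq_of_mem_positiveCone hB c a]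

theorem injOn_formFunctional (hP : P ≠ 0) (hρt : ∀ a, ρ (ρ a) = twist P t a) :
    Set.InjOn (formFunctional P) (positiveCone P ρ) := by
  intro B hB B' hB' h
  have key : ∀ a, B a 1 = B' a 1 := fun a => by
    have h1 := (isTwistedTrace_of_mem_positiveCone hρt hB).eq_component hP a
    have h2 := (isTwistedTrace_of_mem_positiveCone hρt hB').eq_component hP a
    rw [LinearMap.flip_apply, LinearMap.flip_apply] at h1 h2
    rw [h1, h2]
    exact DFunLike.congr_fun h (component P 0 a)
  ext a b
  rw [apply_eq_of_mem_positiveCone hB, apply_eq_of_mem_positiveCone hB', key]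

theorem image_formFunctional (hρ : IsConjugation P lam lamStar ρ)
    (hρt : ∀ a, ρ (ρ a) = twist P t a) :
    formFunctional P '' positiveCone P ρ = {T | IsPositiveTrace P t ρ T} := by
  ext T
  constructor
  · rintro ⟨B, hB, rfl⟩
    refine ⟨B.flip 1, isTwistedTrace_of_mem_positiveCone hρt hB, fun R => rfl, ?_⟩
    have : (fun a b => B.flip 1 (a * ρ b)) = fun a b => B a b := by
      funext a b
      rw [LinearMap.flip_apply, ← apply_eq_of_mem_positiveCone hB]
    rw [this]
    exact hB.1
  · rintro ⟨T', -, hres, hpos⟩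
    refine ⟨LinearMap.mk₂'ₛₗ (RingHom.id ℂ) (starRingEnd ℂ) (fun a b => T' (a * ρ b))
      (fun a a' b => by rw [add_mul, map_add]) (fun c a b => by simp)
      (fun a b b' => by rw [map_add, mul_add, map_add])
      (fun c a b => by simp [hρ.antilinear]), ⟨hpos, fun a b y => ?_⟩, ?_⟩
    · simp [mul_assoc]
    · refine LinearMap.ext fun R => ?_
      simp [formFunctional, hres]

end Cone

end

/-! ### Construction of conjugations. -/

noncomputable section
variable {P : ℂ[X]} {t : ℂˣ} {lam lamStar : ℂ}

/-- The algebra `𝒜_P` with the conjugate action of scalars. -/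
def ConjAlg (P : ℂ[X]) : Type := Alg P

instance (P : ℂ[X]) : Ring (ConjAlg P) := inferInstanceAs (Ring (Alg P))

/-- The identity map, as a ring isomorphism. -/
def conjAlgEquiv (P : ℂ[X]) : ConjAlg P ≃+* Alg P := RingEquiv.refl (Alg P)

instance (P : ℂ[X]) : Algebra ℂ (ConjAlg P) :=
  RingHom.toAlgebra' ((conjAlgEquiv P).symm.toRingHom.comp
    ((algebraMap ℂ (Alg P)).comp (starRingEnd ℂ))) fun c a =>
      Algebra.commutes (A := Alg P) ((starRingEnd ℂ) c) (conjAlgEquiv P a)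

theorem conjAlgEquiv_algebraMap (c : ℂ) :
    conjAlgEquiv P (algebraMap ℂ _ c) = algebraMap ℂ _ ((starRingEnd ℂ) c) := rfl

/-- The values of the conjugation on the generators. -/
def conjugationGen (P : ℂ[X]) (lam lamStar : ℂ) : Gen → ConjAlg P
  | Gen.u => (conjAlgEquiv P).symm (lamStar • v P)
  | Gen.v => (conjAlgEquiv P).symm (lam • u P)
  | Gen.z => (conjAlgEquiv P).symm (-z P)

/-- The conjugation on the free algebra. -/
def conjugationFree (P : ℂ[X]) (lam lamStar : ℂ) : FreeAlgebra ℂ Gen →ₐ[ℂ] ConjAlg P :=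
  FreeAlgebra.lift ℂ (conjugationGen P lam lamStar)

theorem conjugationFree_u :
    conjAlgEquiv P (conjugationFree P lam lamStar (FreeAlgebra.ι ℂ Gen.u)) = lamStar • v P := by
  rw [conjugationFree, FreeAlgebra.lift_ι_apply]
  exact (conjAlgEquiv P).apply_symm_apply _

theorem conjugationFree_v :
    conjAlgEquiv P (conjugationFree P lam lamStar (FreeAlgebra.ι ℂ Gen.v)) = lam • u P := by
  rw [conjugationFree, FreeAlgebra.lift_ι_apply]
  exact (conjAlgEquiv P).apply_symm_apply _

theorem conjugationFree_z :
    conjAlgEquiv P (conjugationFree P lam lamStar (FreeAlgebra.ι ℂ Gen.z)) = -z P := by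
  rw [conjugationFree, FreeAlgebra.lift_ι_apply]
  exact (conjAlgEquiv P).apply_symm_apply _

theorem conjugationFree_aeval (c : ℂ) (R : ℂ[X]) :
    conjAlgEquiv P (conjugationFree P lam lamStar
      (Polynomial.aeval (FreeAlgebra.ι ℂ Gen.z + algebraMap ℂ (FreeAlgebra ℂ Gen) c) R))
      = polyZ P (conjNeg (shift c R)) := by
  have : ((conjAlgEquiv P).toRingHom.comp (conjugationFree P lam lamStar).toRingHom).comp
      (Polynomial.aeval (FreeAlgebra.ι ℂ Gen.z + algebraMap ℂ (FreeAlgebra ℂ Gen) c)).toRingHom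
      = (polyZ P).toRingHom.comp (conjNeg.comp (shift c).toRingHom) := by
    apply Polynomial.ringHom_ext
    · intro a
      simp [conjAlgEquiv_algebraMap]
    · simp [conjAlgEquiv_algebraMap, conjugationFree_z]
  exact DFunLike.congr_fun this R

theorem conjugationFree_rel (hP : conjNeg P = (lam * lamStar) • P) ⦃a b : FreeAlgebra ℂ Gen⦄
    (h : Rel P a b) : conjugationFree P lam lamStar a = conjugationFree P lam lamStar b := by
  apply (conjAlgEquiv P).injective
  cases h with
  | zu =>
    simp only [map_sub, map_mul, map_neg, conjugationFree_u, conjugationFree_z, mul_smul_comm,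
      smul_mul_assoc, neg_mul, mul_neg]
    rw [sub_eq_iff_eq_add.1 (z_mul_v P), smul_neg, smul_add]
    abel
  | zv =>
    simp only [map_sub, map_mul, conjugationFree_v, conjugationFree_z, mul_smul_comm,
      smul_mul_assoc, neg_mul, mul_neg]
    rw [sub_eq_iff_eq_add.1 (z_mul_u P), smul_neg, smul_add, smul_neg]
    abel
  | vu =>
    rw [sub_eq_add_neg, ← map_neg, conjugationFree_aeval, map_mul, map_mul, conjugationFree_u,
      conjugationFree_v, smul_mul_smul_comm, u_mul_v_eq, conjNeg_shift_neg_half, hP, map_smul,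
      map_smul]
  | uv =>
    rw [conjugationFree_aeval, map_mul, map_mul, conjugationFree_u,
      conjugationFree_v, smul_mul_smul_comm, v_mul_u_eq, conjNeg_shift_half, hP, map_smul,
      map_smul, mul_comm]

/-- An antilinear map into `Alg P` is a ℂ-algebra map into `ConjAlg P`, so the presentation by
generators and relations applies. -/
theorem exists_antilinear_ringHom (hP : conjNeg P = (lam * lamStar) • P) :
    ∃ φ : Alg P →+* Alg P, (∀ (c : ℂ) (a : Alg P), φ (c • a) = (starRingEnd ℂ) c • φ a) ∧
      φ (v P) = lam • u P ∧ φ (u P) = lamStar • v P ∧ φ (z P) = -z P := by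
  let ψ : Alg P →ₐ[ℂ] ConjAlg P := RingQuot.liftAlgHom ℂ (s := Rel P)
    ⟨conjugationFree P lam lamStar, conjugationFree_rel hP⟩
  have hψ : ∀ x, ψ (gen P x) = conjugationFree P lam lamStar (FreeAlgebra.ι ℂ x) := fun x =>
    RingQuot.liftAlgHom_mkAlgHom_apply ℂ (conjugationFree P lam lamStar)
      (conjugationFree_rel hP) (FreeAlgebra.ι ℂ x)
  refine ⟨(conjAlgEquiv P).toRingHom.comp ψ.toRingHom, fun c a => ?_, ?_, ?_, ?_⟩
  · rw [Algebra.smul_def, map_mul, Algebra.smul_def]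
    congr 1
    simp [conjAlgEquiv_algebraMap]
  · exact (congrArg (conjAlgEquiv P) (hψ Gen.v)).trans conjugationFree_v
  · exact (congrArg (conjAlgEquiv P) (hψ Gen.u)).trans conjugationFree_u
  · exact (congrArg (conjAlgEquiv P) (hψ Gen.z)).trans conjugationFree_z

theorem twist_twist (s t : ℂˣ) (a : Alg P) : twist P s (twist P t a) = twist P (s * t) a := by
  induction a using Alg.induction with
  | hc c => simp
  | hu => simp [twist_u, smul_smul, mul_comm]
  | hv => simp [twist_v, smul_smul, mul_comm]
  | hz => simp [twist_z]
  | hadd a b ha hb => simp [ha, hb]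
  | hmul a b ha hb => simp [ha, hb]

theorem twist_one (a : Alg P) : twist P 1 a = a := by
  induction a using Alg.induction with
  | hc c => simp
  | hu => simp [twist_u]
  | hv => simp [twist_v]
  | hz => simp [twist_z]
  | hadd a b ha hb => simp [ha, hb]
  | hmul a b ha hb => simp [ha, hb]

theorem exists_isConjugation (hP : conjNeg P = (lam * lamStar) • P)
    (ht : (starRingEnd ℂ) lam * lamStar = t) (ht' : (starRingEnd ℂ) lamStar * lam = (t⁻¹ : ℂˣ)) :
    ∃ ρ : Alg P ≃+* Alg P, IsConjugation P lam lamStar ρ := by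
  obtain ⟨φ, hsmul, hv, hu, hz⟩ := exists_antilinear_ringHom hP
  have hsq : ∀ a, φ (φ a) = twist P t a := by
    intro a
    induction a using Alg.induction with
    | hc c =>
      rw [AlgHom.commutes]
      simp only [Algebra.algebraMap_eq_smul_one, hsmul, map_one, Complex.conj_conj]
    | hu => rw [hu, hsmul, hv, smul_smul, ht', twist_u]
    | hv => rw [hv, hsmul, hu, smul_smul, ht, twist_v]
    | hz => rw [hz, map_neg, hz, neg_neg, twist_z]
    | hadd a b ha hb => simp [ha, hb]
    | hmul a b ha hb => simp [ha, hb]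
  -- Bijectivity follows because the square of φ is g_t, which has inverse g_{t⁻¹}.
  have hbij : Function.Bijective φ := by
    constructor
    · intro a b h
      have := congrArg φ h
      rw [hsq, hsq] at this
      simpa [twist_twist, twist_one] using congrArg (twist P t⁻¹) this
    · intro a
      refine ⟨φ (twist P t⁻¹ a), ?_⟩
      rw [hsq, twist_twist, mul_inv_cancel, twist_one]
  exact ⟨RingEquiv.ofBijective φ hbij, hsmul, hv, hu, hz⟩

/-! ### Symmetry of the roots and the factorization of P. -/

open Polynomial in
theorem conjNeg_prod_X_sub_C (s : Multiset ℂ) :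
    conjNeg (s.map fun a => X - C a).prod = (-1) ^ s.card *
      ((s.map fun a => -(starRingEnd ℂ) a).map fun a => X - C a).prod := by
  induction s using Multiset.induction_on with
  | empty => simp
  | cons a s ih =>
    simp only [Multiset.map_cons, Multiset.prod_cons, map_mul, ih, Multiset.card_cons, map_sub,
      conjNeg_X, conjNeg_C, map_neg]
    ring

open Polynomial in
theorem conjNeg_eq_smul {c : ℂ} (hP : P.Monic) (h : conjNeg P = c • P) :
    c = (-1) ^ P.natDegree ∧ P.roots.map (fun a => -(starRingEnd ℂ) a) = P.roots := by
  have hs : P = (P.roots.map fun a => X - C a).prod :=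
    ((IsAlgClosed.splits P).eq_prod_roots_of_monic hP)
  have hc : Multiset.card P.roots = P.natDegree := (IsAlgClosed.splits P).natDegree_eq_card_roots.symm
  have h1 := conjNeg_prod_X_sub_C P.roots
  rw [← hs, h, hc] at h1
  set Q := ((P.roots.map fun a => -(starRingEnd ℂ) a).map fun a => X - C a).prod with hQ
  have hQm : Q.Monic := monic_multiset_prod_of_monic _ _ fun a _ => monic_X_sub_C a
  have h2 : c • P = ((-1 : ℂ) ^ P.natDegree) • Q := by
    rw [h1, smul_eq_C_mul]; simp
  have hcc : c = (-1) ^ P.natDegree := by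
    have := congrArg leadingCoeff h2
    rw [smul_eq_C_mul, smul_eq_C_mul, leadingCoeff_mul, leadingCoeff_mul, hP.leadingCoeff,
      hQm.leadingCoeff] at this
    simpa using this
  refine ⟨hcc, ?_⟩
  rw [hcc] at h2
  have h3 : P = Q := smul_right_injective _ (by simp) h2
  conv_rhs => rw [h3, hQ, roots_multiset_prod_X_sub_C]

open Polynomial in
/-- The polynomial with roots the roots of `P` of real part greater than `1/2`. -/
def rightPart (P : ℂ[X]) : ℂ[X] :=
  ((P.roots.filter (fun α : ℂ => 1 / 2 < α.re)).map (fun α => X - C α)).prod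

theorem rightPart_ne_zero : rightPart P ≠ 0 :=
  (Polynomial.monic_multiset_prod_of_monic _ _ fun a _ => Polynomial.monic_X_sub_C a).ne_zero

theorem natDegree_rightPart :
    (rightPart P).natDegree = (P.roots.filter (fun α : ℂ => 1 / 2 < α.re)).card := by
  rw [rightPart, Polynomial.natDegree_multiset_prod_X_sub_C_eq_card]

theorem monic_stripPart : (stripPart P).Monic :=
  Polynomial.monic_multiset_prod_of_monic _ _ fun a _ => Polynomial.monic_X_sub_C a

open Polynomial in
theorem conjNeg_rightPart (h : P.roots.map (fun a => -(starRingEnd ℂ) a) = P.roots) :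
    conjNeg (rightPart P) = (-1) ^ (rightPart P).natDegree *
      ((P.roots.filter (fun α : ℂ => α.re < -(1 / 2))).map (fun α => X - C α)).prod := by
  rw [natDegree_rightPart, rightPart, conjNeg_prod_X_sub_C]
  congr 3
  conv_rhs => rw [← h, Multiset.filter_map]
  congr 1
  refine Multiset.filter_congr fun a _ => ?_
  simp

-- The reflection α ↦ -ᾱ exchanges the roots on the two sides of the strip, so the left factor is M*
-- up to the sign making it monic.
open Polynomial in
theorem eq_stripPart_mul (hP : P.Monic) (h : P.roots.map (fun a => -(starRingEnd ℂ) a) = P.roots) :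
    P = stripPart P * ((-1) ^ (rightPart P).natDegree * (rightPart P * conjNeg (rightPart P))) := by
  have hs : P = (P.roots.map fun a => X - C a).prod :=
    ((IsAlgClosed.splits P).eq_prod_roots_of_monic hP)
  have e : ∀ k : ℕ, ((-1 : ℂ[X]) ^ k) * (-1) ^ k = 1 := fun k => by
    rw [← mul_pow]; simp
  classical
  have hsplit : P.roots = P.roots.filter (fun α : ℂ => |α.re| ≤ 1 / 2) +
      (P.roots.filter (fun α : ℂ => 1 / 2 < α.re) +
        P.roots.filter (fun α : ℂ => α.re < -(1 / 2))) := by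
    conv_lhs => rw [← Multiset.filter_add_not (fun α : ℂ => |α.re| ≤ 1 / 2) P.roots]
    congr 1
    rw [← Multiset.filter_add_not (fun α : ℂ => 1 / 2 < α.re)
      (P.roots.filter fun α : ℂ => ¬|α.re| ≤ 1 / 2), Multiset.filter_filter, Multiset.filter_filter]
    congr 1 <;> refine Multiset.filter_congr fun a _ => ?_ <;> rw [not_le, lt_abs]
    · constructor
      · exact fun h => h.1
      · exact fun h => ⟨h, Or.inl h⟩
    · constructor
      · rintro ⟨h1, h2 | h2⟩
        · exact absurd h2 h1
        · linarith
      · exact fun h => ⟨by linarith, Or.inr (by linarith)⟩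
  rw [conjNeg_rightPart h]
  conv_lhs => rw [hs, hsplit, Multiset.map_add, Multiset.map_add, Multiset.prod_add,
    Multiset.prod_add]
  rw [mul_left_comm (rightPart P), ← mul_assoc ((-1 : ℂ[X]) ^ _), e, one_mul]
  rfl

theorem natDegree_eq_stripPart_add (hP : P.Monic)
    (h : P.roots.map (fun a => -(starRingEnd ℂ) a) = P.roots) :
    P.natDegree = (stripPart P).natDegree + 2 * (rightPart P).natDegree := by
  have hsign : ∀ (k : ℕ) (Q : ℂ[X]), ((-1) ^ k * Q).natDegree = Q.natDegree := fun k Q => by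
    rw [show ((-1 : ℂ[X]) ^ k) = Polynomial.C ((-1) ^ k) by simp]
    exact Polynomial.natDegree_C_mul (by simp)
  have hc : (conjNeg (rightPart P)).natDegree = (rightPart P).natDegree := by
    rw [natDegree_rightPart, rightPart, conjNeg_prod_X_sub_C, hsign,
      Polynomial.natDegree_multiset_prod_X_sub_C_eq_card, Multiset.card_map]
  have h0 : conjNeg (rightPart P) ≠ 0 := conjNeg_eq_zero.not.2 rightPart_ne_zero
  conv_lhs => rw [eq_stripPart_mul hP h]
  rw [Polynomial.natDegree_mul monic_stripPart.ne_zero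
    (mul_ne_zero (pow_ne_zero _ (by simp)) (mul_ne_zero rightPart_ne_zero h0)), hsign,
    Polynomial.natDegree_mul rightPart_ne_zero h0, hc]
  ring

theorem conjNeg_stripPart (hP : P.Monic)
    (h : P.roots.map (fun a => -(starRingEnd ℂ) a) = P.roots) :
    conjNeg (stripPart P) = ((-1 : ℂ) ^ P.natDegree) • stripPart P := by
  classical
  have h1 : (stripPart P).natDegree = (P.roots.filter (fun α : ℂ => |α.re| ≤ 1 / 2)).card := by
    rw [stripPart, Polynomial.natDegree_multiset_prod_X_sub_C_eq_card]
  rw [natDegree_eq_stripPart_add hP h, pow_add, pow_mul, neg_one_sq, one_pow, mul_one, h1,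
    stripPart, conjNeg_prod_X_sub_C, Polynomial.smul_eq_C_mul]
  congr 1
  · simp
  congr 2
  conv_rhs => rw [← h, Multiset.filter_map]
  congr 1
  refine Multiset.filter_congr fun a _ => ?_
  simp

end

/-! ### Nonnegative functionals and growth of moments. -/

noncomputable section
open Polynomial Filter Topology

/-- A functional with `T(R^*) = conj (T R)` and `T(R R^*) ≥ 0`. -/
structure IsNonnegFunctional (T : ℂ[X] →ₗ[ℂ] ℂ) : Prop where
  conj : ∀ R, T (conjNeg R) = (starRingEnd ℂ) (T R)
  nonneg : ∀ R, 0 ≤ (T (R * conjNeg R)).re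

/-- The quadratic form `R ↦ T(R R^*)`. -/
def quadForm (T : ℂ[X] →ₗ[ℂ] ℂ) (R : ℂ[X]) : ℝ := (T (R * conjNeg R)).re

section

variable {T : ℂ[X] →ₗ[ℂ] ℂ}

theorem quadForm_add_le (hT : IsNonnegFunctional T) (A B : ℂ[X]) :
    quadForm T (A + B) ≤ 2 * quadForm T A + 2 * quadForm T B := by
  have h := hT.nonneg (A - B)
  have e : (A + B) * conjNeg (A + B) + (A - B) * conjNeg (A - B)
      = (2 : ℂ) • (A * conjNeg A) + (2 : ℂ) • (B * conjNeg B) := by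
    simp only [map_add, map_sub, two_smul]
    ring
  have h2 := congrArg (fun R => (T R).re) e
  simp only [map_add, map_smul, Complex.add_re, smul_eq_mul] at h2
  norm_num at h2
  rw [← map_add, ← map_sub] at h2
  unfold quadForm
  linarith

theorem norm_sq_le_quadForm (hT : IsNonnegFunctional T) (A B : ℂ[X]) :
    ‖T (A * conjNeg B)‖ ^ 2 ≤ quadForm T A * quadForm T B := by
  let c : PreInnerProductSpace.Core ℂ ℂ[X] :=
    { inner := fun A B => T (B * conjNeg A)
      conj_inner_symm := fun A B => by
        rw [← hT.conj, map_mul, conjNeg_conjNeg, mul_comm]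
      re_inner_nonneg := fun A => hT.nonneg A
      add_left := fun A B C => by rw [map_add, mul_add, map_add]
      smul_left := fun A B r => by
        rw [conjNeg_smul, mul_smul_comm, map_smul, smul_eq_mul] }
  have h := @InnerProductSpace.Core.inner_mul_inner_self_le ℂ ℂ[X] _ _ _ c B A
  have h2 : ‖T (B * conjNeg A)‖ = ‖T (A * conjNeg B)‖ := by
    rw [← RCLike.norm_conj (T (A * conjNeg B)), ← hT.conj, map_mul conjNeg, conjNeg_conjNeg, mul_comm]
  change ‖T (A * conjNeg B)‖ * ‖T (B * conjNeg A)‖ ≤ quadForm T B * quadForm T A at h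
  rw [h2, ← sq] at h
  linarith

/-- By Cauchy–Schwarz it is enough that one factor tends to 0 in the seminorm while the seminorm of
the other converges. -/
theorem tendsto_zero_of_quadForm (hT : IsNonnegFunctional T) {F G : ℕ → ℂ[X]} {a b : ℝ}
    (hF : Tendsto (fun n => quadForm T (F n)) atTop (𝓝 a))
    (hG : Tendsto (fun n => quadForm T (G n)) atTop (𝓝 b)) (hab : a * b = 0) :
    Tendsto (fun n => T (F n * conjNeg (G n))) atTop (𝓝 0) := by
  rw [tendsto_zero_iff_norm_tendsto_zero]
  have h : Tendsto (fun n => ‖T (F n * conjNeg (G n))‖ ^ 2) atTop (𝓝 0) :=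
    squeeze_zero (fun n => by positivity) (fun n => norm_sq_le_quadForm hT _ _) (hab ▸ hF.mul hG)
  simpa [Function.comp_def, Real.sqrt_sq] using (Real.continuous_sqrt.tendsto 0).comp h

end

/-- A functional vanishing on an ideal `(P)` with `P` monic has geometrically bounded moments. -/
theorem exists_norm_le_pow_of_vanish {P : ℂ[X]} (hP : P.Monic) {D : ℂ[X] →ₗ[ℂ] ℂ}
    (hD : ∀ S, D (S * P) = 0) : ∃ C K : ℝ, 0 ≤ C ∧ 1 ≤ K ∧ ∀ k, ‖D (X ^ k)‖ ≤ C * K ^ k := by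
  set n := P.natDegree with hn
  set K : ℝ := 1 + ∑ i ∈ Finset.range n, ‖P.coeff i‖ with hK
  set C : ℝ := ∑ i ∈ Finset.range n, ‖D (X ^ i)‖ with hC
  have hK1 : 1 ≤ K := by
    rw [hK]; linarith [Finset.sum_nonneg fun i (_ : i ∈ Finset.range n) => norm_nonneg (P.coeff i)]
  have hC0 : 0 ≤ C := Finset.sum_nonneg fun i _ => norm_nonneg _
  refine ⟨C, K, hC0, hK1, fun k => ?_⟩
  induction k using Nat.strong_induction_on with
  | _ k ih =>
    rcases lt_or_ge k n with hk | hk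
    · calc ‖D (X ^ k)‖ ≤ C := Finset.single_le_sum (f := fun i => ‖D (X ^ i)‖)
            (fun i _ => norm_nonneg _) (Finset.mem_range.2 hk)
        _ ≤ C * K ^ k := le_mul_of_one_le_right hC0 (one_le_pow₀ hK1)
    · obtain ⟨m, rfl⟩ := Nat.exists_eq_add_of_le hk
      have h := hD (X ^ m)
      -- Vanishing on X^m · P is a linear recurrence of order n for the moments; K bounds the sum of
      -- its coefficients.
      conv at h => lhs; rw [hP.as_sum, ← hn, mul_add, Finset.mul_sum, map_add, map_sum]
      rw [← pow_add, add_comm m] at h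
      have h2 : ∀ i ∈ Finset.range n, D (X ^ m * (Polynomial.C (P.coeff i) * X ^ i))
          = P.coeff i * D (X ^ (i + m)) := fun i _ => by
        rw [mul_left_comm, ← pow_add, add_comm m, ← smul_eq_C_mul, map_smul, smul_eq_mul]
      rw [Finset.sum_congr rfl h2] at h
      rcases Nat.eq_zero_or_pos n with h0 | h0
      · rw [h0] at h ⊢
        simp only [Finset.range_zero, Finset.sum_empty, add_zero] at h
        rw [h, norm_zero]
        positivity
      rw [eq_neg_of_add_eq_zero_left h, norm_neg]
      calc ‖∑ i ∈ Finset.range n, P.coeff i * D (X ^ (i + m))‖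
          ≤ ∑ i ∈ Finset.range n, ‖P.coeff i‖ * (C * K ^ (n + m - 1)) := by
            refine norm_sum_le_of_le _ fun i hi => ?_
            rw [Finset.mem_range] at hi
            rw [norm_mul]
            gcongr
            refine (ih (i + m) (by omega)).trans ?_
            gcongr
            omega
        _ = (∑ i ∈ Finset.range n, ‖P.coeff i‖) * (C * K ^ (n + m - 1)) := by
            rw [← Finset.sum_mul]
        _ ≤ K * (C * K ^ (n + m - 1)) := by
            gcongr
            rw [hK]; linarith
        _ = C * K ^ (n + m - 1 + 1) := by ring
        _ = C * K ^ (n + m) := by rw [Nat.sub_add_cancel (by omega)]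

/-- Division of a power series of positive radius of convergence by one with nonzero constant
term. -/
theorem exists_norm_le_pow_of_convolution {f d m : ℕ → ℂ} {F G K : ℝ} (hF : ∀ i, ‖f i‖ ≤ F)
    (hK : 1 ≤ K) (hd : ∀ k, ‖d k‖ ≤ G * K ^ k) (h0 : f 0 ≠ 0)
    (h : ∀ k, ∑ j ∈ Finset.range (k + 1), f (k - j) * m j = d k) :
    ∃ C A : ℝ, 0 ≤ C ∧ 1 ≤ A ∧ ∀ k, ‖m k‖ ≤ C * A ^ k := by
  have hf0 : 0 < ‖f 0‖ := norm_pos_iff.2 h0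
  have hF0 : 0 ≤ F := (norm_nonneg _).trans (hF 0)
  have hG0 : 0 ≤ G := by simpa using (norm_nonneg _).trans (hd 0)
  -- C and A are chosen so that the inhomogeneous term and the earlier terms of the recursion each
  -- take at most half of ‖f 0‖ · C · A^k.
  set A : ℝ := K + 2 * F / ‖f 0‖ with hA
  set C : ℝ := 2 * G / ‖f 0‖ with hC
  have hFA : 0 ≤ 2 * F / ‖f 0‖ := by positivity
  have hC0 : 0 ≤ C := by positivity
  have hA1 : 1 ≤ A := by linarith
  refine ⟨C, A, hC0, hA1, fun k => ?_⟩
  induction k using Nat.strong_induction_on with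
  | _ k ih =>
    have hk := h k
    rw [Finset.sum_range_succ, Nat.sub_self] at hk
    have h1 : ‖f 0‖ * ‖m k‖ ≤ G * K ^ k + F * ∑ j ∈ Finset.range k, C * A ^ j := by
      rw [← norm_mul, eq_sub_of_add_eq' hk]
      refine (norm_sub_le _ _).trans (add_le_add (hd k) ?_)
      rw [Finset.mul_sum]
      refine norm_sum_le_of_le _ fun j hj => ?_
      rw [norm_mul]
      exact mul_le_mul (hF _) (ih j (Finset.mem_range.1 hj)) (norm_nonneg _) hF0
    have h2 : 2 * F * ∑ j ∈ Finset.range k, A ^ j ≤ ‖f 0‖ * A ^ k := by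
      have h3 := mul_geom_sum A k
      have h4 : 0 ≤ ∑ j ∈ Finset.range k, A ^ j := by positivity
      have h5 : 2 * F ≤ ‖f 0‖ * (A - 1) := by
        have : 2 * F = ‖f 0‖ * (2 * F / ‖f 0‖) := by field_simp
        rw [this]
        gcongr
        linarith
      calc _ ≤ ‖f 0‖ * (A - 1) * ∑ j ∈ Finset.range k, A ^ j := by gcongr
        _ = ‖f 0‖ * (A ^ k - 1) := by rw [mul_assoc, h3]
        _ ≤ _ := by gcongr; linarith
    have h6 : G * K ^ k ≤ ‖f 0‖ * C / 2 * A ^ k := by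
      have : ‖f 0‖ * C / 2 = G := by rw [hC]; field_simp
      rw [this]
      gcongr
      linarith
    rw [← Finset.mul_sum] at h1
    have h7 := mul_le_mul_of_nonneg_left h2 hC0
    refine le_of_mul_le_mul_left ?_ hf0
    linarith

/-- The factorial growth condition on the moments of `T`. -/
def HasMomentBound (T : ℂ[X] →ₗ[ℂ] ℂ) (C A : ℝ) : Prop :=
  ∀ k : ℕ, ‖T (X ^ k)‖ ≤ C * k.factorial * A ^ k

theorem map_shift_X_pow (T : ℂ[X] →ₗ[ℂ] ℂ) (c : ℂ) (k : ℕ) :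
    T (shift c (X ^ k)) = k.factorial * ∑ j ∈ Finset.range (k + 1),
      c ^ (k - j) / (k - j).factorial * (T (X ^ j) / j.factorial) := by
  rw [map_pow, shift_X, add_pow, map_sum, Finset.mul_sum]
  refine Finset.sum_congr rfl fun j hj => ?_
  have hj' : j ≤ k := by simpa [Nat.lt_succ_iff] using hj
  rw [← map_pow, mul_assoc, mul_comm, ← C_eq_natCast, ← C_mul, ← smul_eq_C_mul, map_smul,
    smul_eq_mul]
  have h1 := Nat.choose_mul_factorial_mul_factorial hj'
  have h2 : ((k.choose j : ℕ) : ℂ) * j.factorial * (k - j).factorial = k.factorial := by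
    exact_mod_cast h1
  rw [← h2]
  have h3 : (j.factorial : ℂ) ≠ 0 := by exact_mod_cast j.factorial_ne_zero
  have h4 : ((k - j).factorial : ℂ) ≠ 0 := by exact_mod_cast (k - j).factorial_ne_zero
  field_simp

/-- The defect D of the trace equation vanishes on (P), so its moments grow geometrically. In
exponential generating functions, the series of D is that of T times e^{-y/2} - t e^{y/2}; dividing
by this factor keeps a positive radius of convergence. -/
theorem exists_hasMomentBound {P : ℂ[X]} (hP : P.Monic) {t : ℂ} {T : ℂ[X] →ₗ[ℂ] ℂ}
    (hT : ∀ S, T (shift (-(1 / 2)) (S * P)) = t * T (shift (1 / 2) (S * P))) :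
    ∃ C A : ℝ, 0 ≤ C ∧ 1 ≤ A ∧ HasMomentBound T C A := by
  let D : ℂ[X] →ₗ[ℂ] ℂ := T.comp (shift (-(1 / 2))).toLinearMap
    - t • T.comp (shift (1 / 2)).toLinearMap
  have hDapp : ∀ R, D R = T (shift (-(1 / 2)) R) - t * T (shift (1 / 2) R) := fun R => rfl
  obtain ⟨G, K, hG, hK, hD⟩ := exists_norm_le_pow_of_vanish hP (D := D)
    (fun S => by rw [hDapp, hT, sub_self])
  let e : ℕ → ℂ := fun i => ((-(1 / 2)) ^ i - t * (1 / 2) ^ i) / i.factorial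
  let m : ℕ → ℂ := fun j => T (X ^ j) / j.factorial
  have hfac : ∀ k : ℕ, (1 : ℝ) ≤ k.factorial := fun k => by exact_mod_cast k.factorial_pos
  have he : ∀ i, ‖e i‖ ≤ 1 + ‖t‖ := fun i => by
    have h2 : ‖(1 / 2 : ℂ)‖ ^ i ≤ 1 := pow_le_one₀ (norm_nonneg _) (by norm_num)
    calc ‖e i‖ ≤ ‖(-(1 / 2 : ℂ)) ^ i - t * (1 / 2) ^ i‖ := by
          rw [norm_div, Complex.norm_natCast]
          exact div_le_self (norm_nonneg _) (hfac i)
      _ ≤ ‖(1 / 2 : ℂ)‖ ^ i + ‖t‖ * ‖(1 / 2 : ℂ)‖ ^ i := by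
          refine (norm_sub_le _ _).trans_eq ?_
          rw [norm_mul, norm_pow, norm_pow, norm_neg]
      _ ≤ _ := by nlinarith [norm_nonneg t]
  have hsum : ∀ k, ∑ j ∈ Finset.range (k + 1), e (k - j) * m j = D (X ^ k) / k.factorial := by
    intro k
    have h0 : (k.factorial : ℂ) ≠ 0 := by exact_mod_cast k.factorial_ne_zero
    rw [hDapp, map_shift_X_pow, map_shift_X_pow, eq_div_iff h0, Finset.mul_sum, Finset.mul_sum,
      Finset.mul_sum, ← Finset.sum_sub_distrib, Finset.sum_mul]
    refine Finset.sum_congr rfl fun j _ => ?_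
    simp only [e, m]
    ring
  have hd : ∀ k, ‖D (X ^ k) / k.factorial‖ ≤ G * K ^ k := fun k => by
    rw [norm_div, Complex.norm_natCast]
    exact (div_le_self (norm_nonneg _) (hfac k)).trans (hD k)
  have hm : ∃ C A : ℝ, 0 ≤ C ∧ 1 ≤ A ∧ ∀ k, ‖m k‖ ≤ C * A ^ k := by
    -- For t = 1 the divisor has a simple zero at y = 0, so one power of y is cancelled first; its
    -- next coefficient is -1.
    by_cases ht : e 0 = 0
    · refine exists_norm_le_pow_of_convolution (f := fun i => e (i + 1))
        (d := fun k => D (X ^ (k + 1)) / (k + 1).factorial) (G := G * K) (fun i => he (i + 1)) hK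
        (fun k => (hd (k + 1)).trans_eq (by ring)) ?_ fun k => ?_
      · have : t = 1 := by
          have : 1 - t = 0 := by simpa [e] using ht
          linear_combination -this
        simp [e, this]
        norm_num
      · rw [← hsum (k + 1), Finset.sum_range_succ _ (k + 1), Nat.sub_self, ht, zero_mul, add_zero]
        refine Finset.sum_congr rfl fun j hj => ?_
        rw [Nat.sub_add_comm (by simpa [Nat.lt_succ_iff] using hj)]
    · exact exists_norm_le_pow_of_convolution he hK hd ht hsum
  obtain ⟨C, A, hC, hA, h⟩ := hm
  refine ⟨C, A, hC, hA, fun k => ?_⟩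
  have h1 := h k
  simp only [m, norm_div, Complex.norm_natCast] at h1
  rw [div_le_iff₀ (by linarith [hfac k])] at h1
  linarith

end

/-! ### Taylor polynomials of exponentials in the seminorm of T. -/

noncomputable section
open Polynomial Filter Topology

theorem factorial_add_le (m n : ℕ) :
    ((m + n).factorial : ℝ) ≤ 2 ^ (m + n) * (m.factorial * n.factorial) := by
  have h1 := Nat.add_choose_mul_factorial_mul_factorial m n
  have h2 := Nat.choose_le_two_pow (m + n) n
  rw [← h1]
  push_cast
  rw [mul_assoc]
  gcongr
  exact_mod_cast h2

section

variable {T : ℂ[X] →ₗ[ℂ] ℂ} {K A : ℝ}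

theorem norm_map_linear_mul_le (hK : 0 ≤ K) (hA : 0 ≤ A) {b : ℝ} {Y : ℂ[X]} {N : ℕ}
    (hY : ∀ m : ℕ, ‖T (Y * X ^ m)‖ ≤ K * (m + N).factorial * A ^ m * (A + b) ^ N)
    {e c : ℂ} (he : ‖e‖ = 1) (hc : ‖c‖ ≤ b) (m : ℕ) :
    ‖T ((C e * X + C c) * Y * X ^ m)‖
      ≤ K * (m + (N + 1)).factorial * A ^ m * (A + b) ^ (N + 1) := by
  have hb : 0 ≤ b := (norm_nonneg _).trans hc
  have e1 : (C e * X + C c) * Y * X ^ m = e • (Y * X ^ (m + 1)) + c • (Y * X ^ m) := by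
    rw [smul_eq_C_mul, smul_eq_C_mul]; ring
  rw [e1, map_add, map_smul, map_smul, smul_eq_mul, smul_eq_mul]
  refine (norm_add_le _ _).trans ?_
  rw [norm_mul, norm_mul, he, one_mul]
  have h1 := hY (m + 1)
  have h2 := hY m
  rw [show m + 1 + N = m + (N + 1) by ring] at h1
  have h3 : ((m + N).factorial : ℝ) ≤ (m + (N + 1)).factorial := by
    exact_mod_cast Nat.factorial_le (by omega)
  calc ‖T (Y * X ^ (m + 1))‖ + ‖c‖ * ‖T (Y * X ^ m)‖
      ≤ K * (m + (N + 1)).factorial * A ^ (m + 1) * (A + b) ^ N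
        + b * (K * (m + (N + 1)).factorial * A ^ m * (A + b) ^ N) := by
        gcongr
        exact h2.trans (by gcongr)
    _ = K * (m + (N + 1)).factorial * A ^ m * (A + b) ^ (N + 1) := by ring

theorem norm_map_pow_mul_pow_le (hK : 0 ≤ K) (hA : 0 ≤ A) (hT : HasMomentBound T K A) {b : ℝ}
    {c d : ℂ} (hc : ‖c‖ ≤ b) (hd : ‖d‖ ≤ b) (j k m : ℕ) :
    ‖T ((X + C c) ^ j * (-X + C d) ^ k * X ^ m)‖
      ≤ K * (m + (j + k)).factorial * A ^ m * (A + b) ^ (j + k) := by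
  induction j generalizing m with
  | zero =>
    induction k generalizing m with
    | zero => simpa using hT m
    | succ k ih =>
      have := norm_map_linear_mul_le hK hA ih (e := -1) (by simp) hd m
      rw [show (X + C c) ^ 0 * (-X + C d) ^ (k + 1) = (C (-1) * X + C d) *
        ((X + C c) ^ 0 * (-X + C d) ^ k) by rw [C_neg, C_1]; ring]
      exact this
  | succ j ih =>
    have := norm_map_linear_mul_le hK hA ih (e := 1) (by simp) hc m
    rw [show (X + C c) ^ (j + 1) * (-X + C d) ^ k = (C 1 * X + C c) *
      ((X + C c) ^ j * (-X + C d) ^ k) by rw [C_1]; ring, show j + 1 + k = j + k + 1 by ring]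
    exact this

/-- The extra factor 2^{j+k} pays for splitting (m + j + k)! when B contains X^m, so that K' does
not depend on j and k. -/
theorem exists_norm_map_pow_mul_pow_mul_le (hK : 0 ≤ K) (hA : 0 ≤ A) (hT : HasMomentBound T K A)
    {b : ℝ} {c d : ℂ} (hc : ‖c‖ ≤ b) (hd : ‖d‖ ≤ b) (B : ℂ[X]) :
    ∃ K' : ℝ, 0 ≤ K' ∧ ∀ j k : ℕ, ‖T ((X + C c) ^ j * (-X + C d) ^ k * B)‖
      ≤ K' * (j + k).factorial * (2 * (A + b)) ^ (j + k) := by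
  have hb : 0 ≤ b := (norm_nonneg _).trans hc
  induction B using Polynomial.induction_on' with
  | add p q hp hq =>
    obtain ⟨K₁, h₁, hp⟩ := hp
    obtain ⟨K₂, h₂, hq⟩ := hq
    refine ⟨K₁ + K₂, add_nonneg h₁ h₂, fun j k => ?_⟩
    rw [mul_add, map_add]
    refine (norm_add_le_of_le (hp j k) (hq j k)).trans_eq ?_
    ring
  | monomial m a =>
    refine ⟨‖a‖ * K * 2 ^ m * m.factorial * A ^ m, by positivity, fun j k => ?_⟩
    rw [← C_mul_X_pow_eq_monomial, mul_left_comm, ← smul_eq_C_mul, map_smul, norm_smul]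
    calc ‖a‖ * ‖T ((X + C c) ^ j * (-X + C d) ^ k * X ^ m)‖
        ≤ ‖a‖ * (K * (m + (j + k)).factorial * A ^ m * (A + b) ^ (j + k)) := by
          gcongr
          exact norm_map_pow_mul_pow_le hK hA hT hc hd j k m
      _ ≤ ‖a‖ * (K * (2 ^ (m + (j + k)) * (m.factorial * (j + k).factorial)) * A ^ m
          * (A + b) ^ (j + k)) := by
          gcongr
          exact factorial_add_le _ _
      _ = _ := by
          rw [mul_pow, pow_add 2]
          ring

/-- The Taylor polynomials of `exp (s (x - β))`. -/
def truncExp (s : ℝ) (β : ℂ) (n : ℕ) : ℂ[X] :=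
  ∑ k ∈ Finset.range n, C ((s : ℂ) ^ k / k.factorial) * (X - C β) ^ k

theorem shift_truncExp (c : ℂ) (s : ℝ) (β : ℂ) (n : ℕ) :
    shift c (truncExp s β n) = truncExp s (β - c) n := by
  simp only [truncExp, map_sum, map_mul, map_pow, map_sub, shift_X, shift_C]
  refine Finset.sum_congr rfl fun k _ => ?_
  ring

theorem eval_truncExp (s : ℝ) (β : ℂ) (n : ℕ) : (truncExp s β (n + 1)).eval β = 1 := by
  simp [truncExp, eval_finsetSum, Finset.sum_range_succ']

/-- Formally e^{s(x-β)} times its conjugate is the constant e^{-2s Re β}. The moment bound makes the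
double Taylor series absolutely summable for small s, so its sums over squares (the truncations) and
over antidiagonals (the exponential series) agree in the limit. -/
theorem tendsto_quadForm_truncExp (hK : 0 ≤ K) (hA : 0 ≤ A) (hT : HasMomentBound T K A) {b : ℝ}
    {s : ℝ} (hs : 4 * (A + b) * |s| < 1) {β : ℂ} (hβ : ‖β‖ ≤ b) (B : ℂ[X]) :
    Tendsto (fun n => quadForm T (truncExp s β n * B)) atTop
      (𝓝 (Real.exp (-2 * s * β.re) * quadForm T B)) := by
  have hb : 0 ≤ b := (norm_nonneg _).trans hβ
  set β' : ℂ := (starRingEnd ℂ) β with hβ'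
  obtain ⟨K', hK', hbound⟩ := exists_norm_map_pow_mul_pow_mul_le hK hA hT (c := -β) (d := -β')
    (b := b) (by simpa using hβ) (by simpa [hβ'] using hβ) (B * conjNeg B)
  set r : ℝ := 4 * (A + b) * |s| with hr
  have hr0 : 0 ≤ r := by positivity
  let G : ℕ × ℕ → ℂ := fun p => (s : ℂ) ^ p.1 / p.1.factorial * ((s : ℂ) ^ p.2 / p.2.factorial) *
    T ((X + C (-β)) ^ p.1 * (-X + C (-β')) ^ p.2 * (B * conjNeg B))
  have hGb : ∀ p, ‖G p‖ ≤ K' * (r ^ p.1 * r ^ p.2) := by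
    rintro ⟨j, k⟩
    simp only [G, norm_mul, norm_div, norm_pow, Complex.norm_natCast, Complex.norm_real,
      Real.norm_eq_abs]
    have hj : (0 : ℝ) < j.factorial := by exact_mod_cast j.factorial_pos
    have hk : (0 : ℝ) < k.factorial := by exact_mod_cast k.factorial_pos
    calc |s| ^ j / j.factorial * (|s| ^ k / k.factorial) *
          ‖T ((X + C (-β)) ^ j * (-X + C (-β')) ^ k * (B * conjNeg B))‖
        ≤ |s| ^ j / j.factorial * (|s| ^ k / k.factorial) *
          (K' * (2 ^ (j + k) * (j.factorial * k.factorial)) * (2 * (A + b)) ^ (j + k)) := by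
          gcongr
          refine (hbound j k).trans ?_
          gcongr
          exact factorial_add_le _ _
      _ = K' * (r ^ j * r ^ k) := by
          rw [← pow_add, hr, show 4 * (A + b) * |s| = 2 * (2 * (A + b)) * |s| by ring, mul_pow (2 * (2 * (A + b))),
            mul_pow 2 (2 * (A + b)), pow_add |s|]
          field_simp
  have hGs : Summable G := by
    refine Summable.of_norm_bounded ?_ hGb
    have hg := summable_geometric_of_lt_one hr0 hs
    exact (hg.mul_of_nonneg hg (fun _ => by positivity) (fun _ => by positivity)).mul_left K'
  have hdiag : HasSum (fun n : ℕ => ∑ p ∈ Finset.HasAntidiagonal.antidiagonal n, G p) (∑' p, G p) := by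
    have h1 := Finset.HasAntidiagonal.sigmaAntidiagonalEquivProd.hasSum_iff.2 hGs.hasSum
    refine h1.sigma fun n => ?_
    rw [← Finset.sum_coe_sort]
    exact hasSum_fintype _
  have hexp : HasSum (fun n : ℕ => ∑ p ∈ Finset.HasAntidiagonal.antidiagonal n, G p)
      (Complex.exp ((-2 * s * β.re : ℝ) : ℂ) * T (B * conjNeg B)) := by
    have h1 := (NormedSpace.expSeries_div_hasSum_exp ((-2 * s * β.re : ℝ) : ℂ)).mul_right
      (T (B * conjNeg B))
    rw [← Complex.exp_eq_exp_ℂ] at h1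
    suffices h : ∀ n : ℕ, ∑ p ∈ Finset.HasAntidiagonal.antidiagonal n, G p
        = ((-2 * s * β.re : ℝ) : ℂ) ^ n / n.factorial * T (B * conjNeg B) by
      rw [funext h]
      exact h1
    intro n
    -- The variable cancels in the sum of the two linear factors, so the binomial theorem evaluates
    -- each antidiagonal.
    have h2 : ((X + C (-β)) + (-X + C (-β'))) = C ((-2 * β.re : ℝ) : ℂ) := by
      rw [add_add_add_comm, add_neg_cancel, zero_add, ← C_add, hβ', ← neg_add, Complex.add_conj]
      push_cast
      ring_nf
    have h3 : (((-2 * s * β.re : ℝ) : ℂ) ^ n / n.factorial) * T (B * conjNeg B)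
        = (s : ℂ) ^ n / n.factorial *
          T (((X + C (-β)) + (-X + C (-β'))) ^ n * (B * conjNeg B)) := by
      rw [h2, ← C_pow, ← smul_eq_C_mul, map_smul, smul_eq_mul]
      push_cast
      ring
    rw [h3, (Commute.all _ _).add_pow' n, Finset.sum_mul, map_sum, Finset.mul_sum]
    refine Finset.sum_congr rfl fun p hp => ?_
    rw [Finset.HasAntidiagonal.mem_antidiagonal] at hp
    subst hp
    have e := Nat.add_choose_mul_factorial_mul_factorial p.1 p.2
    have e1 : (((p.1 + p.2).choose p.1 : ℕ) : ℂ) * p.1.factorial * p.2.factorial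
        = (p.1 + p.2).factorial := by
      rw [Nat.choose_symm_add]
      exact_mod_cast e
    have f1 : (p.1.factorial : ℂ) ≠ 0 := by exact_mod_cast p.1.factorial_ne_zero
    have f2 : (p.2.factorial : ℂ) ≠ 0 := by exact_mod_cast p.2.factorial_ne_zero
    have f3 : ((p.1 + p.2).choose p.1 : ℂ) ≠ 0 := by
      exact_mod_cast (Nat.choose_pos (Nat.le_add_right _ _)).ne'
    rw [smul_mul_assoc, map_nsmul, nsmul_eq_mul, ← e1, pow_add]
    simp only [G]
    field_simp
  have hval := hdiag.unique hexp
  have hsq : Tendsto (fun n => Finset.range n ×ˢ Finset.range n) atTop atTop := by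
    refine tendsto_atTop_finset_of_monotone ?_ fun p => ⟨max p.1 p.2 + 1, ?_⟩
    · intro m n h
      exact Finset.product_subset_product (Finset.range_mono h) (Finset.range_mono h)
    · simp
  have hlim := hGs.hasSum.comp hsq
  rw [hval] at hlim
  have hre := (Complex.continuous_re.tendsto _).comp hlim
  have h4 : (Complex.exp ((-2 * s * β.re : ℝ) : ℂ) * T (B * conjNeg B)).re
      = Real.exp (-2 * s * β.re) * quadForm T B := by
    rw [← Complex.ofReal_exp, Complex.re_ofReal_mul, quadForm]
  rw [h4] at hre
  refine hre.congr fun n => ?_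
  simp only [Function.comp_apply, quadForm]
  congr 1
  rw [Finset.sum_product, map_mul conjNeg, mul_mul_mul_comm, truncExp, map_sum, Finset.sum_mul_sum,
    Finset.sum_mul, map_sum]
  refine Finset.sum_congr rfl fun j _ => ?_
  rw [Finset.sum_mul, map_sum]
  refine Finset.sum_congr rfl fun k _ => ?_
  simp only [G]
  rw [← smul_eq_mul, ← map_smul, smul_eq_C_mul]
  congr 1
  simp only [map_mul, map_pow, map_sub, conjNeg_X, conjNeg_C, map_div₀, Complex.conj_ofReal,
    map_natCast, C_neg, ← sub_eq_add_neg]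
  ring

end

end

/-! ### Approximating 1 on the boundary of the strip. -/

noncomputable section
open Polynomial Filter Topology

section

variable {T : ℂ[X] →ₗ[ℂ] ℂ} {K A : ℝ}

/-- The sum of the squared norms of `R B`, `B ∈ F`, on the two boundary lines of the strip. -/
def stripForm (T : ℂ[X] →ₗ[ℂ] ℂ) (F : Finset ℂ[X]) (R : ℂ[X]) : ℝ :=
  ∑ B ∈ F, (quadForm T (shift (1 / 2) (R * B)) + quadForm T (shift (-(1 / 2)) (R * B)))

/-- Shifting by c = ±1/2 replaces α by α - c. When s has the sign of Re α, both factors e^{-2s Re(α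
- c)} are at most κ < 1, precisely because |Re α| > 1/2. Crucially, κ does not depend on R. -/
theorem exists_contraction (hK : 0 ≤ K) (hA : 1 ≤ A) (hm : HasMomentBound T K A)
    (hT : IsNonnegFunctional T) {α : ℂ} (hα : 1 / 2 < |α.re|) (F : Finset ℂ[X]) :
    ∃ κ : ℝ, 0 ≤ κ ∧ κ < 1 ∧ ∀ (R : ℂ[X]) (δ : ℝ), 0 < δ →
      ∃ e : ℂ[X], e.eval α = 1 ∧ stripForm T F (e * R) ≤ κ * stripForm T F R + δ := by
  set b : ℝ := ‖α‖ + 1 / 2 with hb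
  have hb0 : 0 < b := by positivity
  set s₀ : ℝ := 1 / (8 * (A + b)) with hs₀
  -- This s₀ makes the geometric ratio 4(A + b)|s| equal to 1/2; b bounds ‖α ± 1/2‖.
  have hs₀pos : 0 < s₀ := by positivity
  have hs : ∃ s : ℝ, |s| = s₀ ∧ s * α.re = s₀ * |α.re| := by
    rcases le_total 0 α.re with h | h
    · exact ⟨s₀, abs_of_pos hs₀pos, by rw [abs_of_nonneg h]⟩
    · exact ⟨-s₀, by rw [abs_neg, abs_of_pos hs₀pos], by rw [abs_of_nonpos h]; ring⟩
  obtain ⟨s, hs1, hs2⟩ := hs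
  have hsmall : 4 * (A + b) * |s| < 1 := by
    have hAb : A + b ≠ 0 := by positivity
    rw [hs1, hs₀]
    field_simp
    norm_num
  have hslt := abs_le.1 hs1.le
  set κ : ℝ := Real.exp (-2 * (s₀ * (|α.re| - 1 / 2))) with hκ
  have hpos : 0 < s₀ * (|α.re| - 1 / 2) := mul_pos hs₀pos (by linarith)
  refine ⟨κ, (Real.exp_pos _).le, Real.exp_lt_one_iff.2 (by linarith), fun R δ hδ => ?_⟩
  have hlim : ∀ (c : ℝ), |c| = 1 / 2 → ∀ B : ℂ[X],
      Tendsto (fun n => quadForm T (shift (c : ℂ) (truncExp s α n * R * B))) atTop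
        (𝓝 (Real.exp (-2 * s * (α - c).re) * quadForm T (shift (c : ℂ) (R * B)))) := by
    intro c hc B
    have := tendsto_quadForm_truncExp hK (by linarith) hm hsmall (β := α - c) (by
      refine (norm_sub_le _ _).trans ?_
      rw [Complex.norm_real, Real.norm_eq_abs, hc]) (shift (c : ℂ) (R * B))
    simpa only [← shift_truncExp, ← map_mul, ← mul_assoc] using this
  have hle : ∀ (c : ℝ), |c| = 1 / 2 → ∀ B : ℂ[X],
      Real.exp (-2 * s * (α - c).re) * quadForm T (shift (c : ℂ) (R * B))
        ≤ κ * quadForm T (shift (c : ℂ) (R * B)) := by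
    intro c hc B
    refine mul_le_mul_of_nonneg_right (Real.exp_le_exp.2 ?_) (hT.nonneg _)
    rw [Complex.sub_re, Complex.ofReal_re]
    have h1 : s * c ≤ s₀ * (1 / 2) := by
      rw [← hs1, ← hc, ← abs_mul]
      exact le_abs_self _
    nlinarith
  have e1 : ((1 / 2 : ℝ) : ℂ) = 1 / 2 := by push_cast; rfl
  have e2 : ((-(1 / 2) : ℝ) : ℂ) = -(1 / 2) := by push_cast; rfl
  have a1 : |(1 / 2 : ℝ)| = 1 / 2 := abs_of_pos (by norm_num)
  have a2 : |(-(1 / 2) : ℝ)| = 1 / 2 := by rw [abs_neg, a1]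
  have l1 := hlim (1 / 2) a1
  have l2 := hlim (-(1 / 2)) a2
  have k1 := hle (1 / 2) a1
  have k2 := hle (-(1 / 2)) a2
  rw [e1] at l1 k1
  rw [e2] at l2 k2
  have hsum : Tendsto (fun n => stripForm T F (truncExp s α n * R)) atTop
      (𝓝 (∑ B ∈ F, (Real.exp (-2 * s * (α - 1 / 2).re) * quadForm T (shift (1 / 2) (R * B)) +
        Real.exp (-2 * s * (α - -(1 / 2)).re) * quadForm T (shift (-(1 / 2)) (R * B))))) :=
    tendsto_finsetSum _ fun B _ => (l1 B).add (l2 B)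
  have hbound : (∑ B ∈ F, (Real.exp (-2 * s * (α - 1 / 2).re) * quadForm T (shift (1 / 2) (R * B)) +
      Real.exp (-2 * s * (α - -(1 / 2)).re) * quadForm T (shift (-(1 / 2)) (R * B))))
      < κ * stripForm T F R + δ := by
    refine lt_of_le_of_lt ?_ (lt_add_of_pos_right _ hδ)
    rw [stripForm, Finset.mul_sum]
    refine Finset.sum_le_sum fun B _ => ?_
    rw [mul_add]
    exact add_le_add (k1 B) (k2 B)
  obtain ⟨n, hn⟩ := ((hsum.comp (tendsto_add_atTop_nat 1)).eventually_lt_const hbound).exists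
  exact ⟨truncExp s α (n + 1), eval_truncExp _ _ _, hn.le⟩

theorem exists_stripForm_lt (hK : 0 ≤ K) (hA : 1 ≤ A) (hm : HasMomentBound T K A)
    (hT : IsNonnegFunctional T) {α : ℂ} (hα : 1 / 2 < |α.re|) (F : Finset ℂ[X]) {ε : ℝ}
    (hε : 0 < ε) : ∃ e : ℂ[X], e.eval α = 1 ∧ stripForm T F e < ε := by
  obtain ⟨κ, hκ0, hκ1, h⟩ := exists_contraction hK hA hm hT hα F
  have iter : ∀ (n : ℕ) (δ : ℝ), 0 < δ →
      ∃ e : ℂ[X], e.eval α = 1 ∧ stripForm T F e ≤ κ ^ n * stripForm T F 1 + n * δ := by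
    intro n δ hδ
    induction n with
    | zero => exact ⟨1, by simp, by simp⟩
    | succ n ih =>
      obtain ⟨e, he, hle⟩ := ih
      obtain ⟨e', he', hle'⟩ := h e δ hδ
      refine ⟨e' * e, by simp [he, he'], hle'.trans ?_⟩
      have h1 : κ * (n * δ) ≤ n * δ := mul_le_of_le_one_left (by positivity) hκ1.le
      calc κ * stripForm T F e + δ ≤ κ * (κ ^ n * stripForm T F 1 + n * δ) + δ := by gcongr
        _ ≤ κ ^ (n + 1) * stripForm T F 1 + (n + 1 : ℕ) * δ := by
            push_cast
            linarith [pow_succ' κ n, h1, (by ring : κ * (κ ^ n * stripForm T F 1 + n * δ)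
              = κ ^ (n + 1) * stripForm T F 1 + κ * (n * δ))]
  have hlim : Tendsto (fun n => κ ^ n * stripForm T F 1) atTop (𝓝 (0 * stripForm T F 1)) :=
    (tendsto_pow_atTop_nhds_zero_of_lt_one hκ0 hκ1).mul_const _
  rw [zero_mul] at hlim
  obtain ⟨n, hn⟩ := (hlim.eventually_lt_const (half_pos hε)).exists
  obtain ⟨e, he, hle⟩ := iter n (ε / (2 * (n + 1))) (by positivity)
  refine ⟨e, he, hle.trans_lt ?_⟩
  have : (n : ℝ) * (ε / (2 * (n + 1))) ≤ ε / 2 := by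
    have : (n : ℝ) / (n + 1) ≤ 1 := by
      rw [div_le_one (by positivity)]; linarith
    calc (n : ℝ) * (ε / (2 * (n + 1))) = ε / 2 * ((n : ℝ) / (n + 1)) := by field_simp
      _ ≤ ε / 2 := mul_le_of_le_one_right (by positivity) this
  linarith

theorem quadForm_le_stripForm (hT : IsNonnegFunctional T) {F : Finset ℂ[X]} {B : ℂ[X]}
    (hB : B ∈ F) (R : ℂ[X]) :
    quadForm T (shift (1 / 2) (R * B)) + quadForm T (shift (-(1 / 2)) (R * B))
      ≤ stripForm T F R :=
  Finset.single_le_sum (f := fun B => quadForm T (shift (1 / 2) (R * B)) +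
    quadForm T (shift (-(1 / 2)) (R * B)))
    (fun _ _ => add_nonneg (hT.nonneg _) (hT.nonneg _)) hB

theorem stripForm_add_le (hT : IsNonnegFunctional T) (F : Finset ℂ[X]) (R S : ℂ[X]) :
    stripForm T F (R + S) ≤ 2 * stripForm T F R + 2 * stripForm T F S := by
  simp only [stripForm, Finset.mul_sum, ← Finset.sum_add_distrib]
  refine Finset.sum_le_sum fun B _ => ?_
  rw [add_mul, map_add, map_add]
  linarith [quadForm_add_le hT (shift (1 / 2) (R * B)) (shift (1 / 2) (S * B)),
    quadForm_add_le hT (shift (-(1 / 2)) (R * B)) (shift (-(1 / 2)) (S * B))]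

/-- Multiples of a polynomial with no roots in the closed strip approximate `1`. -/
theorem exists_stripForm_one_sub_lt (hK : 0 ≤ K) (hA : 1 ≤ A) (hm : HasMomentBound T K A)
    (hT : IsNonnegFunctional T) (s : Multiset ℂ) (hs : ∀ α ∈ s, 1 / 2 < |α.re|)
    (F : Finset ℂ[X]) {ε : ℝ} (hε : 0 < ε) :
    ∃ S : ℂ[X], stripForm T F (1 - (s.map fun a => X - C a).prod * S) < ε := by
  classical
  induction s using Multiset.induction_on generalizing ε with
  | empty => exact ⟨1, by simpa [stripForm, quadForm] using hε⟩
  | cons α s ih =>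
    obtain ⟨S, hS⟩ := ih (fun a ha => hs a (Multiset.mem_cons_of_mem ha)) (ε := ε / 4)
      (by positivity)
    set M := (s.map fun a => X - C a).prod with hM
    have hcard : (0 : ℝ) < F.card + 1 := by positivity
    -- The test set is enlarged by the factor M S already built, so that e makes e · M · S small
    -- against F. This is why the test set must be arbitrary.
    obtain ⟨e, he, hlt⟩ := exists_stripForm_lt hK hA hm hT (hs α (Multiset.mem_cons_self _ _))
      (F.image fun B => M * S * B) (ε := ε / (4 * (F.card + 1))) (by positivity)
    obtain ⟨W, hW⟩ : X - C α ∣ 1 - e := by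
      rw [dvd_iff_isRoot, IsRoot.def, eval_sub, he, eval_one, sub_self]
    refine ⟨S * W, ?_⟩
    have e1 : 1 - ((α ::ₘ s).map fun a => X - C a).prod * (S * W) = (1 - M * S) + e * (M * S) := by
      rw [Multiset.map_cons, Multiset.prod_cons, ← hM]
      linear_combination (M * S) * hW
    rw [e1]
    have h2 : stripForm T F (e * (M * S)) ≤ F.card * (ε / (4 * (F.card + 1))) := by
      rw [stripForm, ← nsmul_eq_mul]
      refine Finset.sum_le_card_nsmul _ _ _ fun B hB => ?_
      have := quadForm_le_stripForm hT (Finset.mem_image_of_mem (fun B => M * S * B) hB) e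
      simp only [← mul_assoc] at this hlt ⊢
      linarith
    have h3 : (F.card : ℝ) * (ε / (4 * (F.card + 1))) < ε / 4 := by
      rw [← div_div, mul_div_assoc', div_lt_iff₀ hcard]
      nlinarith
    linarith [stripForm_add_le hT F (1 - M * S) (e * (M * S))]

theorem exists_tendsto_stripForm (hK : 0 ≤ K) (hA : 1 ≤ A) (hm : HasMomentBound T K A)
    (hT : IsNonnegFunctional T) (s : Multiset ℂ) (hs : ∀ α ∈ s, 1 / 2 < |α.re|)
    (F : Finset ℂ[X]) :
    ∃ S : ℕ → ℂ[X], ∀ B ∈ F,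
      Tendsto (fun n => quadForm T (shift (1 / 2)
        ((1 - (s.map fun a => X - C a).prod * S n) * B))) atTop (𝓝 0) ∧
      Tendsto (fun n => quadForm T (shift (-(1 / 2))
        ((1 - (s.map fun a => X - C a).prod * S n) * B))) atTop (𝓝 0) := by
  choose S hS using fun n : ℕ => exists_stripForm_one_sub_lt hK hA hm hT s hs F
    (ε := 1 / ((n : ℝ) + 1)) (by positivity)
  refine ⟨S, fun B hB => ?_⟩
  have h0 := fun n => quadForm_le_stripForm hT hB (1 - (s.map fun a => X - C a).prod * S n)
  have hlim := tendsto_one_div_add_atTop_nhds_zero_nat (𝕜 := ℝ)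
  refine ⟨squeeze_zero (fun n => hT.nonneg _) (fun n => ?_) hlim,
    squeeze_zero (fun n => hT.nonneg _) (fun n => ?_) hlim⟩
  · have : 0 ≤ quadForm T (shift (-(1 / 2)) _) :=
      hT.nonneg (shift (-(1 / 2)) ((1 - (s.map fun a => X - C a).prod * S n) * B))
    linarith [h0 n, hS n]
  · have : 0 ≤ quadForm T (shift (1 / 2) _) :=
      hT.nonneg (shift (1 / 2) ((1 - (s.map fun a => X - C a).prod * S n) * B))
    linarith [h0 n, hS n]

end

end

/-! ### Transferring positivity between P and its strip part. -/

noncomputable section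
open Polynomial Filter Topology

theorem IsPositiveFunctional.isNonnegFunctional {P : ℂ[X]} {t lam : ℂ} {T : ℂ[X] →ₗ[ℂ] ℂ}
    (h : IsPositiveFunctional P t lam T) : IsNonnegFunctional T := by
  refine ⟨h.conj, fun R => ?_⟩
  rcases eq_or_ne R 0 with rfl | hR
  · simp
  · exact (h.pos R hR).le

theorem neg_one_pow_mul_self {R : Type*} [CommRing R] (k : ℕ) : (-1 : R) ^ k * (-1) ^ k = 1 := by
  rw [← mul_pow]; simp

section

variable {P₀ M : ℂ[X]} {k : ℕ} {t lam : ℂ} {T : ℂ[X] →ₗ[ℂ] ℂ}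

theorem pairing_mul_sign (W : ℂ[X]) :
    lam * T (shift (-(1 / 2)) (W * conjNeg W * (P₀ * ((-1) ^ k * (M * conjNeg M)))))
      = (-1) ^ k * lam * T (shift (-(1 / 2)) (M * W * conjNeg (M * W) * P₀)) := by
  have e : W * conjNeg W * (P₀ * ((-1) ^ k * (M * conjNeg M)))
      = ((-1 : ℂ) ^ k) • (M * W * conjNeg (M * W) * P₀) := by
    rw [smul_eq_C_mul, map_mul]
    simp only [map_pow, map_neg, map_one]
    ring
  rw [e, map_smul, map_smul, smul_eq_mul]
  ring

/-- A positive functional for `P₀` is positive for `± P₀ M M^*`. -/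
theorem IsPositiveFunctional.mul_conjNeg (hM : M ≠ 0)
    (h : IsPositiveFunctional P₀ t ((-1) ^ k * lam) T) :
    IsPositiveFunctional (P₀ * ((-1) ^ k * (M * conjNeg M))) t lam T where
  trace S := by
    have := h.trace (S * ((-1) ^ k * (M * conjNeg M)))
    rwa [show S * ((-1) ^ k * (M * conjNeg M)) * P₀ = S * (P₀ * ((-1) ^ k * (M * conjNeg M))) by
      ring] at this
  conj := h.conj
  pos := h.pos
  pos_shift R hR := by
    rw [pairing_mul_sign]
    exact h.pos_shift _ (mul_ne_zero hM hR)

/-- The trace condition passes from `P₀ N` to `P₀` if `N` has no roots in the closed strip. -/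
theorem trace_of_trace_mul {N : ℂ[X]} {s : Multiset ℂ} (hN : N = (s.map fun a => X - C a).prod)
    (hs : ∀ α ∈ s, 1 / 2 < |α.re|) (hT : IsNonnegFunctional T) (hP₀ : P₀.Monic)
    (h : ∀ S, T (shift (-(1 / 2)) (S * (P₀ * N))) = t * T (shift (1 / 2) (S * (P₀ * N))))
    (S : ℂ[X]) : T (shift (-(1 / 2)) (S * P₀)) = t * T (shift (1 / 2) (S * P₀)) := by
  have hNm : N.Monic := hN ▸ monic_multiset_prod_of_monic _ _ fun a _ => monic_X_sub_C a
  obtain ⟨K, A, hK, hA, hm⟩ := exists_hasMomentBound (hP₀.mul hNm) h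
  obtain ⟨W, hW⟩ := exists_tendsto_stripForm hK hA hm hT s hs {S * P₀}
  obtain ⟨h1, h2⟩ := hW _ (Finset.mem_singleton_self _)
  rw [← hN] at h1 h2
  have hone : Tendsto (fun _ : ℕ => quadForm T 1) atTop (𝓝 (quadForm T 1)) := tendsto_const_nhds
  have l1 := tendsto_zero_of_quadForm hT h1 hone (zero_mul _)
  have l2 := tendsto_zero_of_quadForm hT h2 hone (zero_mul _)
  simp only [map_one, mul_one] at l1 l2
  have l3 := l2.sub (l1.const_mul t)
  rw [mul_zero, sub_zero] at l3
  -- The defect already vanishes on multiples of P₀ N, so replacing S P₀ by (1 - N W n) S P₀ leaves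
  -- it unchanged; the latter defects tend to 0.
  have e : ∀ n, T (shift (-(1 / 2)) ((1 - N * W n) * (S * P₀)))
      - t * T (shift (1 / 2) ((1 - N * W n) * (S * P₀)))
      = T (shift (-(1 / 2)) (S * P₀)) - t * T (shift (1 / 2) (S * P₀)) := fun n => by
    have e1 : (1 - N * W n) * (S * P₀) = S * P₀ - S * W n * (P₀ * N) := by ring
    rw [e1, map_sub, map_sub, map_sub, map_sub, h]
    ring
  simp only [e] at l3
  exact sub_eq_zero.1 (tendsto_nhds_unique tendsto_const_nhds l3)

/-- The functional `R ↦ lam T(R(x - 1/2) P(x - 1/2))`. -/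
def weightedFunctional (P : ℂ[X]) (lam : ℂ) (T : ℂ[X] →ₗ[ℂ] ℂ) : ℂ[X] →ₗ[ℂ] ℂ :=
  lam • T.comp ((shift (-(1 / 2))).toLinearMap.comp (LinearMap.mulRight ℂ P))

theorem weightedFunctional_apply (P R : ℂ[X]) (lam : ℂ) (T : ℂ[X] →ₗ[ℂ] ℂ) :
    weightedFunctional P lam T R = lam * T (shift (-(1 / 2)) (R * P)) := rfl

/-- Conjugation moves the shift from -1/2 to 1/2, and the trace equation for P₀ moves it back. -/
theorem weightedFunctional_conjNeg (hT : ∀ R, T (conjNeg R) = (starRingEnd ℂ) (T R))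
    (htr : ∀ S, T (shift (-(1 / 2)) (S * P₀)) = t * T (shift (1 / 2) (S * P₀))) {ε : ℂ}
    (hε : conjNeg P₀ = ε • P₀) (hlam : lam * t = (starRingEnd ℂ) lam * ε) (R : ℂ[X]) :
    weightedFunctional P₀ lam T (conjNeg R) = (starRingEnd ℂ) (weightedFunctional P₀ lam T R) := by
  rw [weightedFunctional_apply, weightedFunctional_apply, map_mul (starRingEnd ℂ), ← hT, conjNeg_shift_neg_half,
    map_mul conjNeg, hε, mul_smul_comm, map_smul, map_smul, smul_eq_mul, htr, ← mul_assoc, hlam,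
    mul_assoc]

theorem weightedFunctional_mul_conjNeg (R S : ℂ[X]) :
    weightedFunctional P₀ lam T (R * conjNeg S)
      = lam * T (shift (-(1 / 2)) (R * P₀) * conjNeg (shift (1 / 2) S)) := by
  rw [weightedFunctional_apply, conjNeg_shift_half, ← map_mul]
  congr 3
  ring

/-- A functional which is positive for `± P₀ M M^*`, where `M` has no roots in the closed strip
`|Re x| ≤ 1/2`, is positive for `P₀`. -/
theorem IsPositiveFunctional.of_mul_conjNeg {s : Multiset ℂ}
    (hN : (-1) ^ k * (M * conjNeg M) = (s.map fun a => X - C a).prod)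
    (hs : ∀ α ∈ s, 1 / 2 < |α.re|) (hP₀ : P₀.Monic) {ε : ℂ}
    (hε : conjNeg P₀ = ε • P₀) (hlam : lam * t = (starRingEnd ℂ) lam * ε)
    (h : IsPositiveFunctional (P₀ * ((-1) ^ k * (M * conjNeg M))) t lam T) :
    IsPositiveFunctional P₀ t ((-1) ^ k * lam) T := by
  have hT := h.isNonnegFunctional
  have htr := trace_of_trace_mul hN hs hT hP₀ h.trace
  set N := (-1) ^ k * (M * conjNeg M) with hNdef
  set lam₀ := (-1) ^ k * lam with hlam₀
  have hNm : N.Monic := hN ▸ monic_multiset_prod_of_monic _ _ fun a _ => monic_X_sub_C a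
  obtain ⟨K, A, hK, hA, hm⟩ := exists_hasMomentBound (hP₀.mul hNm) h.trace
  set b := weightedFunctional P₀ lam₀ T with hb
  have hbconj : ∀ R, b (conjNeg R) = (starRingEnd ℂ) (b R) :=
    weightedFunctional_conjNeg hT.conj htr hε (by
      rw [hlam₀, map_mul, mul_assoc, hlam]
      simp [mul_assoc])
  have hbM : ∀ W, lam * T (shift (-(1 / 2)) (W * conjNeg W * (P₀ * N)))
      = b (M * W * conjNeg (M * W)) := fun W => pairing_mul_sign W
  have hbnonneg : ∀ R, 0 ≤ (b (R * conjNeg R)).re := by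
    intro R
    -- The pairing by b is a mixed T-pairing between the two lines, with P₀ attached on one side
    -- only; hence both R and R P₀ serve as tests.
    obtain ⟨W, hW⟩ := exists_tendsto_stripForm hK hA hm hT s hs {R, R * P₀}
    obtain ⟨h1, -⟩ := hW R (by simp)
    obtain ⟨-, h4⟩ := hW (R * P₀) (by simp)
    rw [← hN] at h1 h4
    set δ : ℕ → ℂ[X] := fun n => (1 - N * W n) * R with hδ
    have hδP : ∀ n, (1 - N * W n) * (R * P₀) = δ n * P₀ := fun n => by rw [hδ]; ring
    simp only [hδP] at h4
    have l1 : Tendsto (fun n => b (δ n * conjNeg R)) atTop (𝓝 0) := by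
      have := (tendsto_zero_of_quadForm hT h4 (tendsto_const_nhds (x := quadForm T
        (shift (1 / 2) R))) (zero_mul _)).const_mul lam₀
      simpa only [hb, weightedFunctional_mul_conjNeg, mul_zero] using this
    have l2 : Tendsto (fun n => b (R * conjNeg (δ n))) atTop (𝓝 0) := by
      have := (tendsto_zero_of_quadForm hT (tendsto_const_nhds (x := quadForm T
        (shift (-(1 / 2)) (R * P₀)))) h1 (mul_zero _)).const_mul lam₀
      simpa only [hb, weightedFunctional_mul_conjNeg, mul_zero] using this
    have l3 : Tendsto (fun n => b (δ n * conjNeg (δ n))) atTop (𝓝 0) := by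
      have := (tendsto_zero_of_quadForm hT h4 h1 (mul_zero _)).const_mul lam₀
      simpa only [hb, weightedFunctional_mul_conjNeg, mul_zero] using this
    have l4 := ((tendsto_const_nhds (x := b (R * conjNeg R)) (f := atTop)).sub (l1.add l2)).add l3
    rw [add_zero, add_zero, sub_zero] at l4
    refine ge_of_tendsto' ((Complex.continuous_re.tendsto _).comp l4) fun n => ?_
    -- The left side is b evaluated on (R - δ)(R - δ)*, and R - δ = N W R is a multiple of M, where
    -- nonnegativity is known.
    have e : b (R * conjNeg R) - (b (δ n * conjNeg R) + b (R * conjNeg (δ n)))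
        + b (δ n * conjNeg (δ n)) = b (M * (conjNeg M * W n * R) *
          conjNeg (M * (conjNeg M * W n * R))) := by
      have e2 : δ n = R - (-1) ^ k * (M * (conjNeg M * W n * R)) := by
        rw [hδ, hNdef]; ring
      rw [← map_add, ← map_sub, ← map_add]
      congr 1
      rw [e2]
      simp only [map_sub, map_mul, map_pow, map_neg, map_one, conjNeg_conjNeg]
      linear_combination (M * (conjNeg M * W n * R)) *
        (conjNeg M * (M * conjNeg (W n) * conjNeg R)) * neg_one_pow_mul_self (R := ℂ[X]) k
    rw [Function.comp_apply, e, ← hbM]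
    rcases eq_or_ne (conjNeg M * W n * R) 0 with h0 | h0
    · rw [h0]; simp
    · exact (h.pos_shift _ h0).le
  have hbN : IsNonnegFunctional b := ⟨hbconj, hbnonneg⟩
  refine ⟨htr, h.conj, h.pos, fun R hR => ?_⟩
  change 0 < (b (R * conjNeg R)).re
  -- If b(RR*) = 0, Cauchy–Schwarz makes R orthogonal to M*MR; that pairing is b(MR(MR)*), which
  -- positivity for P₀ N makes strictly positive.
  refine lt_of_le_of_ne (hbnonneg R) fun h0 => ?_
  have h1 := norm_sq_le_quadForm hbN R (conjNeg M * M * R)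
  rw [quadForm, ← h0, zero_mul] at h1
  have h2 : b (R * conjNeg (conjNeg M * M * R)) = 0 := by
    rw [← norm_eq_zero]
    exact pow_eq_zero_iff (two_ne_zero) |>.1 (le_antisymm h1 (by positivity))
  have h3 := h.pos_shift R hR
  rw [hbM, show M * R * conjNeg (M * R) = R * conjNeg (conjNeg M * M * R) by
    simp only [map_mul, conjNeg_conjNeg]; ring, h2] at h3
  simp at h3

end

theorem isPositiveFunctional_iff_stripPart {P : ℂ[X]} (hP : P.Monic)
    (hroots : P.roots.map (fun a => -(starRingEnd ℂ) a) = P.roots) {t lam : ℂ}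
    (hlam : lam * t = (starRingEnd ℂ) lam * (-1) ^ P.natDegree) (T : ℂ[X] →ₗ[ℂ] ℂ) :
    IsPositiveFunctional P t lam T ↔
      IsPositiveFunctional (stripPart P) t ((-1) ^ (rightPart P).natDegree * lam) T := by
  have hPeq := eq_stripPart_mul hP hroots
  constructor
  · intro h
    rw [hPeq] at h
    refine h.of_mul_conjNeg (s := P.roots.filter (fun α : ℂ => 1 / 2 < α.re) +
      P.roots.filter (fun α : ℂ => α.re < -(1 / 2))) ?_ ?_ monic_stripPart
      (conjNeg_stripPart hP hroots) hlam
    · rw [conjNeg_rightPart hroots, Multiset.map_add, Multiset.prod_add, mul_left_comm,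
        ← mul_assoc ((-1 : ℂ[X]) ^ _), neg_one_pow_mul_self, one_mul]
      rfl
    · intro α hα
      rw [lt_abs]
      rcases Multiset.mem_add.1 hα with h | h
      · exact Or.inl (Multiset.mem_filter.1 h).2
      · exact Or.inr (by linarith [(Multiset.mem_filter.1 h).2])
  · intro h
    have := h.mul_conjNeg (rightPart_ne_zero (P := P))
    rwa [← hPeq] at this

end
end KleinianTrace

/-! ### The main theorem: scalars, signs and assembly. -/

open KleinianTrace in
theorem mainTheorem9 (P : ℂ[X]) (hP : P.Monic) (lam lamStar : ℂ) (hlam : lam ≠ 0)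
    (hlamStar : lamStar ≠ 0) (t : ℂˣ) (ρ : Alg P ≃+* Alg P)
    (hρ : IsConjugation P lam lamStar ρ) (hρt : ∀ a, ρ (ρ a) = twist P t a) :
    -- `(n - n_∘)/2` is a nonnegative integer
    (stripPart P).natDegree ≤ P.natDegree ∧
    Even (P.natDegree - (stripPart P).natDegree) ∧
    -- the conjugation `ρ_∘` exists and squares to `g_t`
    (∃ ρ₀ : Alg (stripPart P) ≃+* Alg (stripPart P),
      IsConjugation (stripPart P) (stripScalar P lam)
        ((-1) ^ P.natDegree * (stripScalar P lam)⁻¹) ρ₀ ∧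
      ∀ a, ρ₀ (ρ₀ a) = twist (stripPart P) t a) ∧
    ∀ ρ₀ : Alg (stripPart P) ≃+* Alg (stripPart P),
      IsConjugation (stripPart P) (stripScalar P lam)
        ((-1) ^ P.natDegree * (stripScalar P lam)⁻¹) ρ₀ →
      -- positive traces for `𝒜_P` and `𝒜_{P_∘}` are the same functionals on `ℂ[x]`
      (∀ T : ℂ[X] →ₗ[ℂ] ℂ,
        IsPositiveTrace P t ρ T ↔ IsPositiveTrace (stripPart P) t ρ₀ T) ∧
      -- the cones of positive definite forms coincide inside the functionals on `ℂ[x]`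
      Set.InjOn (formFunctional P) (positiveCone P ρ) ∧
      Set.InjOn (formFunctional (stripPart P)) (positiveCone (stripPart P) ρ₀) ∧
      formFunctional P '' positiveCone P ρ =
        formFunctional (stripPart P) '' positiveCone (stripPart P) ρ₀ := by
  obtain ⟨hprod, hroots⟩ := conjNeg_eq_smul hP hρ.conjNeg_eq
  have hdeg := natDegree_eq_stripPart_add hP hroots
  have hmul := hρ.conj_mul hP.ne_zero hρt
  set k := (rightPart P).natDegree with hk
  set n := P.natDegree with hn
  have hconj : (starRingEnd ℂ) lam ≠ 0 := (map_ne_zero _).2 hlam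
  have hsc : stripScalar P lam = (-1) ^ k * lam := by
    rw [stripScalar, ← hn, hdeg, Nat.add_sub_cancel_left, Nat.mul_div_cancel_left _ two_pos]
  have hstar : lamStar = (-1) ^ n * lam⁻¹ := by
    rw [← hprod, mul_comm lam, mul_assoc, mul_inv_cancel₀ hlam, mul_one]
  -- This is the compatibility that makes the weighted functional real.
  have hlt : lam * t = (starRingEnd ℂ) lam * (-1) ^ n := by
    rw [← hmul, ← hprod]; ring
  have hk2 : ((-1 : ℂ) ^ k) * (-1) ^ k = 1 := neg_one_pow_mul_self k
  have hn2 : ((-1 : ℂ) ^ n) * (-1) ^ n = 1 := neg_one_pow_mul_self n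
  have hkinv : ((-1 : ℂ) ^ k)⁻¹ = (-1) ^ k := inv_eq_of_mul_eq_one_left hk2
  have hs0 : stripScalar P lam ≠ 0 := by
    rw [hsc]; exact mul_ne_zero (pow_ne_zero _ (by simp)) hlam
  have ht1 : (starRingEnd ℂ) (stripScalar P lam) * ((-1) ^ n * (stripScalar P lam)⁻¹) = t := by
    rw [hsc, map_mul, map_pow, map_neg, map_one, mul_inv, hkinv, ← hmul, hstar]
    linear_combination ((starRingEnd ℂ) lam * (-1) ^ n * lam⁻¹) * hk2
  have ht2 : (starRingEnd ℂ) ((-1) ^ n * (stripScalar P lam)⁻¹) * stripScalar P lam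
      = (t⁻¹ : ℂˣ) := by
    refine (eq_inv_of_mul_eq_one_left ?_).trans (Units.val_inv_eq_inv_val t).symm
    rw [← ht1, map_mul, map_pow, map_neg, map_one, map_inv₀]
    have : (starRingEnd ℂ) (stripScalar P lam) ≠ 0 := (map_ne_zero _).2 hs0
    field_simp
    rw [sq, hn2]
  have hρ₀t : ∀ ρ₀ : Alg (stripPart P) ≃+* Alg (stripPart P),
      IsConjugation (stripPart P) (stripScalar P lam) ((-1) ^ n * (stripScalar P lam)⁻¹) ρ₀ →
      ∀ a, ρ₀ (ρ₀ a) = twist (stripPart P) t a := fun ρ₀ h => h.sq_eq_twist ht1 ht2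
  refine ⟨by omega, ⟨k, by omega⟩, ?_, fun ρ₀ hρ₀ => ?_⟩
  · obtain ⟨ρ₀, h⟩ := exists_isConjugation (P := stripPart P) (t := t) (lam := stripScalar P lam)
      (lamStar := (-1) ^ n * (stripScalar P lam)⁻¹) (by
        rw [conjNeg_stripPart hP hroots, mul_left_comm, mul_inv_cancel₀ hs0, mul_one]) ht1 ht2
    exact ⟨ρ₀, h, hρ₀t ρ₀ h⟩
  · have h0 := monic_stripPart (P := P).ne_zero
    have key : ∀ T : ℂ[X] →ₗ[ℂ] ℂ,
        IsPositiveTrace P t ρ T ↔ IsPositiveTrace (stripPart P) t ρ₀ T := fun T => by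
      rw [isPositiveTrace_iff hP.ne_zero hρ hlam hρt,
        isPositiveTrace_iff h0 hρ₀ hs0 (hρ₀t ρ₀ hρ₀), hsc]
      exact isPositiveFunctional_iff_stripPart hP hroots hlt T
    refine ⟨key, injOn_formFunctional hP.ne_zero hρt, injOn_formFunctional h0 (hρ₀t ρ₀ hρ₀), ?_⟩
    rw [image_formFunctional hρ hρt, image_formFunctional hρ₀ (hρ₀t ρ₀ hρ₀)]
    exact Set.ext key
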